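/- Let $n\ge 2$, let $\mathbf T$ be the unit circle, $D_n\subseteq M_n(\mathbf C)$ the subalgebra of diagonal matrices, and $A=C(\mathbf T)\otimes M_n(\mathbf C)$, i.e. the C$^*$-algebra $M_n(C(\mathbf T))$, with $f\otimes m=(m_{ij}f)_{ij}$. Definitions. A closed commutative $*$-subalgebra $B$ of a C$^*$-algebra $A$ is a Cartan subalgebra if it contains an approximate unit of $A$; is maximal abelian; is regular (its normalizers, i.e. the $v\in A$ with $vBv^*\subseteq B$ and $v^*Bv\subseteq B$, generate $A$ as a C$^*$-algebra); and there is a faithful conditional expectation of $A$ onto $B$. It is a diagonal subalgebra if moreover every pure state of $B$ extends uniquely to a pure state of $A$. The equivalence relation corresponding to a diagonal subalgebra $B$ is the relation on its spectrum $\hat B$ in which $x\sim y$ iff there is a normalizer $v$ of $B$ with $x(v^*v)\ne0$ and $x(v^*bv)=y(b)\,x(v^*v)$ for all $b\in B$. Then the following hold. (a) $B_1=C(\mathbf T)\otimes D_n$ is a diagonal subalgebra of $A$, and $(f_1,\dots,f_n)\mapsto \mathrm{diag}(f_1,\dots,f_n)$ is a $*$-isomorphism of $C(\mathbf T)^n$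 onto $B_1$. (b) Let $\mathbf Z_n=\mathbf Z/n\mathbf Z$ act on $C(\mathbf T)$ by $(\alpha_kf)(z)=f(e^{-2\pi ik/n}z)$. The C$^*$-algebras $A$ and $C(\mathbf T)\rtimes_\alpha\mathbf Z_n$ are $*$-isomorphic. For every $*$-isomorphism $\Phi:A\to C(\mathbf T)\rtimes_\alpha\mathbf Z_n$, the algebra $B_2=\Phi^{-1}(C(\mathbf T))$, where $C(\mathbf T)\subseteq C(\mathbf T)\rtimes_\alpha\mathbf Z_n$ is the canonical copy, is a diagonal subalgebra of $A$, and $f\mapsto\Phi^{-1}(f)$ is a $*$-isomorphism of $C(\mathbf T)$ onto $B_2$. (c) For every such $\Phi$, the algebras $B_1$ and $B_2$ are not isomorphic, not even as rings; in particular no $*$-automorphism of $A$ maps $B_1$ onto $B_2$. (d) Identify $\hat B_1$ with $\mathbf T\times\{1,\dots,n\}$ and $\hat B_2$ with $\mathbf T$ by means of the isomorphisms in (a) and (b). The equivalence relation corresponding to $B_1$ is $(z,i)\sim(w,j)\iff z=w$, given by the trivial covering map $(z,i)\mapsto z$; the one corresponding to $B_2$ is $z\sim w\iff z^n=w^n$,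 given by the covering map $z\mapsto z^n$. Both have a quotient space homeomorphic to $\mathbf T$. -/

import Mathlib

open scoped ComplexOrder TensorProduct

noncomputable section

section States

variable {E : Type*} [NonUnitalNormedRing E] [StarRing E] [NormedSpace ℂ E]

/-- A bounded linear functional is positive if `0 ≤ φ (a⋆ a)` for all `a`
(the order on `ℂ` makes these values real). -/
def IsPositiveFunctional (φ : E →L[ℂ] ℂ) : Prop :=
  ∀ a : E, 0 ≤ φ (star a * a)

/-- A state is a positive functional of norm one. -/
def IsState (φ : E →L[ℂ] ℂ) : Prop :=
  IsPositiveFunctional φ ∧ ‖φ‖ = 1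

/-- A state is pure if the only positive functionals below it are its multiples `t φ`
with `t ∈ [0, 1]`. -/
def IsPureState (φ : E →L[ℂ] ℂ) : Prop :=
  IsState φ ∧ ∀ ψ : E →L[ℂ] ℂ, IsPositiveFunctional ψ → IsPositiveFunctional (φ - ψ) →
    ∃ t : ℝ, 0 ≤ t ∧ t ≤ 1 ∧ ψ = (t : ℂ) • φ

end States

section Diagonals

variable {A : Type*} [NonUnitalCStarAlgebra A]

/-- The normalizer `{v | v B v⋆ ⊆ B and v⋆ B v ⊆ B}` of a subalgebra `B`. -/
def normalizerSet (B : NonUnitalStarSubalgebra ℂ A) : Set A :=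
  {v | ∀ b ∈ B, v * b * star v ∈ B ∧ star v * b * v ∈ B}

/-- `P` is a conditional expectation of `A` onto the subalgebra `B`: a contractive, positive,
`B`-bimodular projection with range `B`. -/
structure IsConditionalExpectation (B : NonUnitalStarSubalgebra ℂ A) (P : A →L[ℂ] A) : Prop where
  mem : ∀ a, P a ∈ B
  apply_of_mem : ∀ b ∈ B, P b = b
  norm_le : ∀ a, ‖P a‖ ≤ ‖a‖
  positive : ∀ a, ∃ c, P (star a * a) = star c * c
  bimodule : ∀ b ∈ B, ∀ c ∈ B, ∀ a, P (b * a * c) = b * P a * c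

/-- Cartan subalgebras of a C⋆-algebra. -/
structure IsCartan (B : NonUnitalStarSubalgebra ℂ A) : Prop where
  isClosed : IsClosed (B : Set A)
  commutative : ∀ b ∈ B, ∀ c ∈ B, b * c = c * b
  approximateUnit : ∃ l : Filter A, l.IsApproximateUnit ∧ ∀ᶠ x in l, x ∈ B
  maximal : ∀ C : NonUnitalStarSubalgebra ℂ A, IsClosed (C : Set A) →
    (∀ b ∈ C, ∀ c ∈ C, b * c = c * b) → B ≤ C → C = B
  regular : (NonUnitalStarAlgebra.adjoin ℂ (normalizerSet B)).topologicalClosure = ⊤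
  expectation : ∃ P : A →L[ℂ] A, IsConditionalExpectation B P ∧
    ∀ a, P (star a * a) = 0 → a = 0

/-- Every pure state of `B` extends uniquely to a pure state of `A`. -/
def HasUniqueExtension (B : NonUnitalStarSubalgebra ℂ A) : Prop :=
  ∀ φ : B →L[ℂ] ℂ, IsPureState φ →
    ∃! ψ : A →L[ℂ] ℂ, IsPureState ψ ∧ ∀ b : B, ψ (b : A) = φ b

/-- A diagonal subalgebra is a Cartan subalgebra with the unique extension property. -/
def IsDiagonalSubalgebra (B : NonUnitalStarSubalgebra ℂ A) : Prop :=
  IsCartan B ∧ HasUniqueExtension B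

/-- The equivalence relation on the spectrum of `B` given by the partial homeomorphisms `α_v`
attached to the normalizers `v` of `B`: the domain of `α_v` consists of the characters `x` with
`x (v⋆ v) ≠ 0`, and `α_v x = y` means that `x (v⋆ b v) = y b * x (v⋆ v)` for all `b ∈ B`. -/
def spectralRelation (B : NonUnitalStarSubalgebra ℂ A)
    (x y : WeakDual.characterSpace ℂ B) : Prop :=
  ∃ (v : A) (hv : v ∈ normalizerSet B) (s : B), (s : A) = star v * v ∧ x s ≠ 0 ∧
    ∀ b : B, x ⟨star v * b * v, (hv b b.2).2⟩ = y b * x s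

end Diagonals

section CrossedProduct

variable {G : Type*} [Group G] [Fintype G] [DecidableEq G] {B : Type*} [CStarAlgebra B]
  [PartialOrder B] [StarOrderedRing B]

/-- The representation `π` of `B` on the Hilbert `B`-module `ℓ²(G, B)`,
`(π b ξ) t = α_{t⁻¹} b * ξ t`, as a matrix. -/
def regularRep (α : G →* (B ≃⋆ₐ[ℂ] B)) : B →⋆ₐ[ℂ] CStarMatrix G G B where
  toFun b := CStarMatrix.ofMatrix (Matrix.diagonal fun t => α t⁻¹ b)
  map_one' := by
    ext i j
    by_cases h : i = j <;> simp [h, Matrix.diagonal, CStarMatrix.one_apply]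
  map_mul' b c := by
    ext i j
    by_cases h : i = j <;>
      simp [h, Matrix.diagonal, CStarMatrix.mul_apply]
  map_zero' := by
    ext i j
    simp [Matrix.diagonal]
  map_add' b c := by
    ext i j
    by_cases h : i = j <;> simp [h, Matrix.diagonal]
  commutes' r := by
    ext i j
    by_cases h : i = j <;> simp [h, Matrix.diagonal, CStarMatrix.algebraMap_apply, -map_inv, AlgHomClass.commutes]
  map_star' b := by
    ext i j
    by_cases h : i = j
    · simp [h, Matrix.diagonal, CStarMatrix.star_apply, -map_inv, map_star]
    · simp [h, Ne.symm h, Matrix.diagonal, CStarMatrix.star_apply]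

/-- The translation unitaries `(λ_s ξ) t = ξ (s⁻¹ t)` on `ℓ²(G, B)`, as matrices. -/
def translation (B : Type*) [CStarAlgebra B] (s : G) : CStarMatrix G G B :=
  CStarMatrix.ofMatrix fun t u => if u = s⁻¹ * t then 1 else 0

/-- The crossed product `B ⋊_α G` by a finite group `G`, in its regular representation: the
C⋆-algebra generated by `π(B)` and the unitaries `λ_s`, `s ∈ G`, acting on `ℓ²(G, B)`.
(A finite group is amenable, so the full and the reduced crossed products coincide.) -/
def crossedProduct (α : G →* (B ≃⋆ₐ[ℂ] B)) : StarSubalgebra ℂ (CStarMatrix G G B) :=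
  (StarAlgebra.adjoin ℂ (Set.range (regularRep α) ∪ Set.range (translation B))).topologicalClosure

instance (α : G →* (B ≃⋆ₐ[ℂ] B)) : CStarAlgebra (crossedProduct α) :=
  StarSubalgebra.cstarAlgebra _ (h_closed := StarSubalgebra.isClosed_topologicalClosure _)

/-- The canonical embedding `B → B ⋊_α G`. -/
def crossedProductEmbedding (α : G →* (B ≃⋆ₐ[ℂ] B)) : B →⋆ₐ[ℂ] crossedProduct α :=
  StarAlgHom.codRestrict (regularRep α) _ fun b =>
    StarSubalgebra.le_topologicalClosure _
      (StarAlgebra.subset_adjoin ℂ _ (Or.inl (Set.mem_range_self b)))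

end CrossedProduct

section Circle

/-- The C⋆-algebra `M_n(ℂ)`. -/
abbrev MatrixAlg (n : ℕ) : Type := CStarMatrix (Fin n) (Fin n) ℂ

/-- The subalgebra `D_n` of diagonal matrices in `M_n(ℂ)`. -/
def diagonalMatrices (n : ℕ) : Set (MatrixAlg n) :=
  {m | ∀ i j, i ≠ j → m i j = 0}

/-- The C⋆-algebra `C(𝕋) ⊗ M_n(ℂ)`, realized as the algebra of `n × n` matrices over `C(𝕋)`. -/
abbrev CircleMatrixAlg (n : ℕ) : Type := CStarMatrix (Fin n) (Fin n) C(Circle, ℂ)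

/-- The elementary tensor `f ⊗ m` in `C(𝕋) ⊗ M_n(ℂ)`. -/
def elementaryTensor {n : ℕ} (f : C(Circle, ℂ)) (m : MatrixAlg n) : CircleMatrixAlg n :=
  CStarMatrix.ofMatrix fun i j => m i j • f

/-- `C(𝕋) ⊗ D_n`, the closed ⋆-subalgebra of `C(𝕋) ⊗ M_n(ℂ)` generated by the `f ⊗ d` with `d`
diagonal. -/
def circleDiagonal (n : ℕ) : NonUnitalStarSubalgebra ℂ (CircleMatrixAlg n) :=
  (NonUnitalStarAlgebra.adjoin ℂ
    {a | ∃ f : C(Circle, ℂ), ∃ d ∈ diagonalMatrices n, a = elementaryTensor f d}).topologicalClosure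

/-- The action of `ℤ/nℤ` on `C(𝕋)` induced by the rotation of angle `2π/n`:
`(α_k f) z = f (e^{-2πik/n} z)`. -/
def rotationAction (n : ℕ) [NeZero n] :
    Multiplicative (ZMod n) →* (C(Circle, ℂ) ≃⋆ₐ[ℂ] C(Circle, ℂ)) where
  toFun k := (Homeomorph.mulLeft (ZMod.toCircle (-k.toAdd))).compStarAlgEquiv' ℂ ℂ
  map_one' := by
    ext f z
    simp
  map_mul' j k := by
    ext f z
    simp [AddChar.map_add_eq_mul, mul_assoc]

/-- The crossed product `C(𝕋) ⋊ ℤ/nℤ` by the rotation of angle `2π/n`. -/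
abbrev RotationCrossedProduct (n : ℕ) [NeZero n] : Type :=
  crossedProduct (rotationAction n)

/-- The copy of `C(𝕋) ⊆ C(𝕋) ⋊ ℤ/nℤ` in `C(𝕋) ⊗ M_n(ℂ)` obtained through an isomorphism `Φ`. -/
def circleCopy {n : ℕ} [NeZero n] (Φ : CircleMatrixAlg n ≃⋆ₐ[ℂ] RotationCrossedProduct n) :
    NonUnitalStarSubalgebra ℂ (CircleMatrixAlg n) :=
  NonUnitalStarSubalgebra.map Φ.symm
    (NonUnitalStarAlgHom.range (crossedProductEmbedding (rotationAction n)))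

end Circle

end

/-! Both subalgebras are instances of one pattern, `IsFreeCovariantSystem`: a copy of `C(X)` and
finitely many unitaries `u g` that implement homeomorphisms `σ g` of `X` with `σ g x ≠ σ g' x` for
`g ≠ g'`, such that every `a` is a sum of terms `ι (c g a) * u g`. For `B₁`, `X` is `n` copies of
the circle and the `u g` are cyclic permutation matrices, which permute the sheets; for `B₂`, `X` is
the circle, rotated by the `n`-th roots of unity.

Freeness gives the key local fact (`isLocalExpectation`). If `h` is a bump function at `x` with `h *
(h ∘ σ g) = 0` for all `g ≠ o`, then compressing `a` by `h` kills every term except that of the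
unit, so `h a h = h² E(a)` with `E = c o`. Hence `E` is a faithful conditional expectation, an
element commuting with `C(X)` equals its own expectation, and a positive functional extending
evaluation at `x` must be `a ↦ E(a)(x)`. Regularity holds because `A` is generated by `C(X)` and the
normalizing unitaries. The spectral relation is the orbit relation of the `σ g`: the sheets over a
common point for `B₁`, the fibres of `z ↦ z ^ n` for `B₂`.

The isomorphism of `A` with the crossed product is conjugation of `a(z ^ n)` by a unitary Fourier
matrix `V(z)`: the crossed product is the algebra of equivariant matrices, and `V` exchanges these
with the rotation-invariant ones, whose entries are functions of `z ^ n`. An arbitrary `Φ` only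
transports the covariant system. Finally `B₁` and `B₂` differ as rings because the circle is
connected: `C(𝕋)` has only trivial idempotents, while `C(𝕋)^n` has others. -/

open scoped ComplexOrder TensorProduct Matrix

/-! ### Positive functions and positive functionals -/

section Positivity

theorem ContinuousMap.exists_eq_star_mul_self {X : Type*} [TopologicalSpace X] {F : C(X, ℂ)}
    (hF : ∀ x, 0 ≤ F x) : ∃ k : C(X, ℂ), F = star k * k := by
  refine ⟨⟨fun x => (Real.sqrt (F x).re : ℂ), by fun_prop⟩, ?_⟩
  ext x
  have h := Complex.le_def.1 (hF x)
  simp only [Complex.zero_re, Complex.zero_im] at h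
  simp only [mul_apply, star_apply, coe_mk, RCLike.star_def, Complex.conj_ofReal]
  rw [← Complex.ofReal_mul, Real.mul_self_sqrt h.1]
  exact Complex.ext rfl h.2.symm

/-- An affine function that stays nonnegative on the whole real line has slope zero. -/
theorem eq_zero_of_forall_real_nonneg {z r : ℂ} (h : ∀ t : ℝ, 0 ≤ (t : ℂ) * z + r) : z = 0 := by
  have h0 := Complex.le_def.1 (h 0)
  have h1 := Complex.le_def.1 (h 1)
  simp at h0 h1
  apply Complex.ext
  · by_contra hz
    -- This value of `t` makes the real part equal to `-1`.
    have h2 := (Complex.le_def.1 (h (-(r.re + 1) / z.re))).1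
    have hz' : z.re ≠ 0 := hz
    simp [Complex.add_re, Complex.mul_re] at h2
    norm_cast at h2
    simp at h2
    rw [div_mul_cancel₀ _ hz'] at h2
    linarith
  · simp only [Complex.zero_im]
    linarith [h1.2, h0.2]

variable {A : Type*} [NonUnitalNormedRing A] [StarRing A] [NormedSpace ℂ A]
  [SMulCommClass ℂ A A] [IsScalarTower ℂ A A] [StarModule ℂ A]

/-- The degenerate case of Cauchy–Schwarz. In `ρ ((tsb + c)⋆ (tsb + c)) ≥ 0` the term quadratic in
`t` vanishes, so the linear one must vanish too; `s = 1` and `s = i` then separate its two summands.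
-/
theorem IsPositiveFunctional.apply_star_mul_eq_zero {ρ : A →L[ℂ] ℂ} (hρ : IsPositiveFunctional ρ)
    {b : A} (hb : ρ (star b * b) = 0) (c : A) : ρ (star b * c) = 0 ∧ ρ (star c * b) = 0 := by
  have key : ∀ s : ℂ, star s * ρ (star b * c) + s * ρ (star c * b) = 0 := by
    intro s
    refine eq_zero_of_forall_real_nonneg (r := ρ (star c * c)) fun t => ?_
    have := hρ (((t : ℂ) * s) • b + c)
    simp only [star_add, star_smul, add_mul, mul_add, smul_mul_assoc, mul_smul_comm, map_add,
      map_smul, hb, smul_eq_mul, mul_zero, zero_add] at this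
    convert this using 1
    simp
    ring
  have h1 := key 1
  have h2 := key Complex.I
  simp only [star_one, one_mul, RCLike.star_def, Complex.conj_I] at h1 h2
  have h3 : ρ (star b * c) = ρ (star c * b) := by
    have : Complex.I * (ρ (star c * b) - ρ (star b * c)) = 0 := by linear_combination h2
    exact (sub_eq_zero.1 ((mul_eq_zero_iff_left Complex.I_ne_zero).1 this)).symm
  rw [h3] at h1 ⊢
  have : ρ (star c * b) = 0 := by linear_combination h1 / 2
  exact ⟨this, this⟩

end Positivity

theorem CStarAlgebra.star_mul_self_eq_zero_of_add_eq_zero {A : Type*} [CStarAlgebra A] {p q : A}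
    (h : star p * p + star q * q = 0) : star p * p = 0 := by
  let _ := CStarAlgebra.spectralOrder A
  have _ := CStarAlgebra.spectralOrderedRing A
  exact ((add_eq_zero_iff_of_nonneg (star_mul_self_nonneg p) (star_mul_self_nonneg q)).1 h).1

/-! ### Expectations given locally by compression -/

section LocalExpectation

variable {X : Type*} [TopologicalSpace X] {A : Type*} [CStarAlgebra A]

/-- Positivity in `A` is pulled back to `C(X)` by testing against the square root `s` of the
negative part of `F`. Since `s² F = -s⁴`, the squares of `b s²` and of `s³` add up to zero, so both
vanish and `s = 0`. -/
theorem StarAlgHom.nonneg_of_map_eq_star_mul_self {ι : C(X, ℂ) →⋆ₐ[ℂ] A}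
    (hι : Function.Injective ι) {F : C(X, ℂ)} {b : A} (h : ι F = star b * b) (x : X) :
    0 ≤ F x := by
  have hF : star F = F := hι (by rw [map_star, h]; simp)
  have him : ∀ y, (F y).im = 0 := fun y => by
    have := congrArg (fun G : C(X, ℂ) => G y) hF
    exact Complex.conj_eq_iff_im.1 this
  let s : C(X, ℂ) := ⟨fun y => (Real.sqrt (max (-(F y).re) 0) : ℂ), by fun_prop⟩
  have hs : star s = s := by ext y; simp [s]
  have hss : ∀ y, s y * s y = ((max (-(F y).re) 0 : ℝ) : ℂ) := fun y => by
    simp only [s, ContinuousMap.coe_mk]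
    rw [← Complex.ofReal_mul, Real.mul_self_sqrt (le_max_right _ _)]
  have hsF : s * s * F = -(s * s * (s * s)) := by
    ext y
    simp only [ContinuousMap.mul_apply, ContinuousMap.neg_apply, hss]
    rw [show F y = ((F y).re : ℂ) from Complex.ext rfl (him y), ← Complex.ofReal_mul,
      ← Complex.ofReal_mul, ← Complex.ofReal_neg, Complex.ofReal_re]
    congr 1
    rcases le_total (-(F y).re) 0 with h' | h'
    · simp [max_eq_right h']
    · rw [max_eq_left h']; ring
  have hz : star (b * ι (s * s)) * (b * ι (s * s)) + star (ι (s * s * s)) * ι (s * s * s) = 0 := by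
    rw [star_mul, ← map_star, ← map_star]
    simp only [star_mul, hs]
    rw [show ι (s * s) * star b * (b * ι (s * s)) = ι (s * s) * (star b * b) * ι (s * s) by
      simp only [mul_assoc], ← h, ← map_mul, ← map_mul, ← map_mul, ← map_add,
      show s * s * F * (s * s) + s * (s * s) * (s * s * s) = 0 by rw [hsF]; ring, map_zero]
  have hz' := CStarAlgebra.star_mul_self_eq_zero_of_add_eq_zero hz
  rw [hz', zero_add, CStarRing.star_mul_self_eq_zero_iff, map_eq_zero_iff ι hι] at hz
  have hx : s x * s x * s x = 0 := congrArg (fun G : C(X, ℂ) => G x) hz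
  have hx' : s x = 0 := by simpa using hx
  have hm := hss x
  rw [hx', mul_zero] at hm
  have hm' : max (-(F x).re) 0 = 0 := by exact_mod_cast hm.symm
  rw [Complex.le_def]
  refine ⟨?_, (him x).symm⟩
  have := max_eq_right_iff.1 hm'
  simpa using this

open scoped CStarAlgebra in
-- The functions `f` with `a * ι f = 0` form a closed ideal of `C(X)` without common zero, and such
-- an ideal contains `1`.
theorem StarAlgHom.eq_zero_of_forall_mul_map_eq_zero [CompactSpace X] [T2Space X]
    {ι : C(X, ℂ) →⋆ₐ[ℂ] A} {a : A}
    (h : ∀ x, ∃ f : C(X, ℂ), f x ≠ 0 ∧ a * ι f = 0) : a = 0 := by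
  let I : Ideal C(X, ℂ) :=
    { carrier := {f | a * ι f = 0}
      add_mem' := fun {f g} hf hg => by
        simp only [Set.mem_ofPred_eq] at hf hg ⊢
        rw [map_add, mul_add, hf, hg, add_zero]
      zero_mem' := by simp
      smul_mem' := fun c f hf => by
        simp only [Set.mem_ofPred_eq] at hf ⊢
        rw [smul_eq_mul, mul_comm, map_mul, ← mul_assoc, hf, zero_mul] }
  have hI : IsClosed (I : Set C(X, ℂ)) :=
    isClosed_eq (continuous_const.mul (map_continuous ι)) continuous_const
  have hset : ContinuousMap.setOfIdeal I = Set.univ := by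
    refine Set.eq_univ_of_forall fun x => ?_
    obtain ⟨f, hfx, hf⟩ := h x
    exact ContinuousMap.mem_setOfIdeal.2 ⟨f, hf, hfx⟩
  have h1 : (1 : C(X, ℂ)) ∈ I := by
    rw [← ContinuousMap.idealOfSet_ofIdeal_isClosed hI, hset]
    exact ContinuousMap.mem_idealOfSet.2 (by simp)
  have : a * ι 1 = 0 := h1
  simpa using this

theorem StarAlgHom.compress_star_mul_self {ι : C(X, ℂ) →⋆ₐ[ℂ] A} {E : A → C(X, ℂ)}
    {k : C(X, ℂ)} (hk : star k = k)
    (hka : ∀ b, ι k * b * ι k = ι (k * k * E b)) (a : A) :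
    ι (k * k * E (star a * a)) = star (a * ι k) * (a * ι k) := by
  rw [← hka, star_mul, ← map_star, hk]
  simp only [mul_assoc]

variable [CompactSpace X]

/-- `E` is locally the compression by functions of the subalgebra `ι (C(X))`: every point of `X`
has a self-adjoint contraction `h` with value one there and `h a h = h² E(a)` for all `a`. -/
structure IsLocalExpectation (ι : C(X, ℂ) →⋆ₐ[ℂ] A) (E : A → C(X, ℂ)) : Prop where
  injective : Function.Injective ι
  compress : ∀ x, ∃ h : C(X, ℂ), star h = h ∧ ‖h‖ ≤ 1 ∧ h x = 1 ∧
    ∀ a, ι h * a * ι h = ι (h * h * E a)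

namespace IsLocalExpectation

variable {ι : C(X, ℂ) →⋆ₐ[ℂ] A} {E : A → C(X, ℂ)}

/-- All algebraic properties of `E`, linearity included, come from this: compute the compression of
`a` in a second way, compare by injectivity of `ι`, and evaluate at `x`, where `k = 1`. -/
theorem apply_eq (hE : IsLocalExpectation ι E) {a : A} {x : X} {z : ℂ}
    (h : ∀ k : C(X, ℂ), star k = k → k x = 1 → (∀ b, ι k * b * ι k = ι (k * k * E b)) →
      ∃ F : C(X, ℂ), ι k * a * ι k = ι F ∧ F x = z) : E a x = z := by
  obtain ⟨k, hk, -, hkx, hka⟩ := hE.compress x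
  obtain ⟨F, hF, hFx⟩ := h k hk hkx hka
  rw [hka, hE.injective.eq_iff] at hF
  rw [← hFx, ← hF]
  simp [hkx]

theorem map_add (hE : IsLocalExpectation ι E) (a b : A) : E (a + b) = E a + E b := by
  ext x
  refine hE.apply_eq fun k _ hkx hka => ⟨k * k * (E a + E b), ?_, by simp [hkx]⟩
  rw [mul_add, add_mul, hka, hka, mul_add, _root_.map_add]

theorem map_smul (hE : IsLocalExpectation ι E) (c : ℂ) (a : A) : E (c • a) = c • E a := by
  ext x
  refine hE.apply_eq fun k _ hkx hka => ⟨k * k * (c • E a), ?_, by simp [hkx]⟩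
  rw [mul_smul_comm, smul_mul_assoc, hka, mul_smul_comm, _root_.map_smul]

theorem map_mul_mul (hE : IsLocalExpectation ι E) (f g : C(X, ℂ)) (a : A) :
    E (ι f * a * ι g) = f * E a * g := by
  ext x
  refine hE.apply_eq fun k _ hkx hka => ⟨f * (k * k * E a) * g, ?_, by simp [hkx]⟩
  rw [map_mul, map_mul, ← hka]
  simp only [← mul_assoc, ← map_mul, mul_comm k f]
  simp only [mul_assoc, ← map_mul, mul_comm g k]

theorem map_mul_right (hE : IsLocalExpectation ι E) (a : A) (g : C(X, ℂ)) :
    E (a * ι g) = E a * g := by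
  simpa using hE.map_mul_mul 1 g a

theorem apply_map (hE : IsLocalExpectation ι E) (f : C(X, ℂ)) : E (ι f) = f := by
  ext x
  refine hE.apply_eq fun k _ hkx hka => ⟨k * f * k, by simp, by simp [hkx]⟩

theorem norm_le (hE : IsLocalExpectation ι E) (a : A) : ‖E a‖ ≤ ‖a‖ := by
  refine (ContinuousMap.norm_le _ (norm_nonneg _)).2 fun x => ?_
  obtain ⟨k, hk, hk1, hkx, hka⟩ := hE.compress x
  have h1 : ‖ι k‖ ≤ 1 := (NonUnitalStarAlgHom.norm_map ι hE.injective k).trans_le hk1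
  calc ‖E a x‖ = ‖(k * k * E a) x‖ := by simp [hkx]
    _ ≤ ‖k * k * E a‖ := ContinuousMap.norm_coe_le_norm _ x
    _ = ‖ι k * a * ι k‖ := by rw [hka, NonUnitalStarAlgHom.norm_map ι hE.injective]
    _ ≤ ‖ι k‖ * ‖a‖ * ‖ι k‖ := (norm_mul_le _ _).trans (by gcongr; exact norm_mul_le _ _)
    _ ≤ 1 * ‖a‖ * 1 := by gcongr
    _ = ‖a‖ := by simp

theorem nonneg (hE : IsLocalExpectation ι E) (a : A) (x : X) : 0 ≤ E (star a * a) x := by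
  obtain ⟨k, hk, -, hkx, hka⟩ := hE.compress x
  have := StarAlgHom.nonneg_of_map_eq_star_mul_self hE.injective
    (StarAlgHom.compress_star_mul_self hk hka a) x
  simpa [hkx] using this

/-- If `E (a⋆ a) = 0`, then `(a k)⋆ (a k) = k² E (a⋆ a) = 0`, so `a` is annihilated by a bump
function at every point. -/
theorem faithful [T2Space X] (hE : IsLocalExpectation ι E) {a : A} (ha : E (star a * a) = 0) :
    a = 0 := by
  refine StarAlgHom.eq_zero_of_forall_mul_map_eq_zero (ι := ι) fun x => ?_
  obtain ⟨k, hk, -, hkx, hka⟩ := hE.compress x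
  have := StarAlgHom.compress_star_mul_self hk hka a
  rw [ha, mul_zero, map_zero, eq_comm, CStarRing.star_mul_self_eq_zero_iff] at this
  exact ⟨k, by simp [hkx], this⟩

/-- If `a` commutes with `C(X)`, then `a k² = k a k = E(a) k²`, so `a - E(a)` is annihilated near
every point. This gives maximality of the subalgebra. -/
theorem eq_of_commute [T2Space X] (hE : IsLocalExpectation ι E) {a : A}
    (ha : ∀ f, ι f * a = a * ι f) : a = ι (E a) := by
  rw [← sub_eq_zero]
  refine StarAlgHom.eq_zero_of_forall_mul_map_eq_zero (ι := ι) fun x => ?_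
  obtain ⟨k, hk, -, hkx, hka⟩ := hE.compress x
  refine ⟨k * k, by simp [hkx], ?_⟩
  have := hka a
  rw [ha, mul_assoc, ← map_mul] at this
  rw [sub_mul, this, ← map_mul, mul_comm (E a), sub_self]

/-- The expectation onto `ι (C(X))`, as an operator on `A`. -/
noncomputable def toContinuousLinearMap (hE : IsLocalExpectation ι E) : A →L[ℂ] A :=
  LinearMap.mkContinuous
    { toFun := fun a => ι (E a)
      map_add' := fun a b => by rw [hE.map_add, _root_.map_add]
      map_smul' := fun c a => by rw [hE.map_smul, _root_.map_smul, RingHom.id_apply] } 1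
    fun a => by
      rw [one_mul]
      exact (NonUnitalStarAlgHom.norm_map ι hE.injective _).trans_le (hE.norm_le a)

/-- The state `a ↦ E(a)(x)`. -/
noncomputable def evalState (hE : IsLocalExpectation ι E) (x : X) : A →L[ℂ] ℂ :=
  LinearMap.mkContinuous
    { toFun := fun a => E a x
      map_add' := fun a b => by rw [hE.map_add, ContinuousMap.add_apply]
      map_smul' := fun c a => by rw [hE.map_smul, ContinuousMap.smul_apply, RingHom.id_apply] } 1
    fun a => by
      rw [one_mul]
      exact (ContinuousMap.norm_coe_le_norm _ x).trans (hE.norm_le a)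

@[simp]
theorem toContinuousLinearMap_apply (hE : IsLocalExpectation ι E) (a : A) :
    hE.toContinuousLinearMap a = ι (E a) := rfl

@[simp]
theorem evalState_apply (hE : IsLocalExpectation ι E) (x : X) (a : A) :
    hE.evalState x a = E a x := rfl

theorem isConditionalExpectation (hE : IsLocalExpectation ι E) {B : NonUnitalStarSubalgebra ℂ A}
    (hB : ∀ a, a ∈ B ↔ ∃ f, ι f = a) : IsConditionalExpectation B hE.toContinuousLinearMap where
  mem a := (hB _).2 ⟨_, rfl⟩
  apply_of_mem b hb := by
    obtain ⟨f, rfl⟩ := (hB b).1 hb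
    rw [toContinuousLinearMap_apply, hE.apply_map]
  norm_le a := (NonUnitalStarAlgHom.norm_map ι hE.injective _).trans_le (hE.norm_le a)
  positive a := by
    obtain ⟨k, hk⟩ := ContinuousMap.exists_eq_star_mul_self (hE.nonneg a)
    exact ⟨ι k, by rw [toContinuousLinearMap_apply, hk, map_mul, map_star]⟩
  bimodule b hb c hc a := by
    obtain ⟨f, rfl⟩ := (hB b).1 hb
    obtain ⟨g, rfl⟩ := (hB c).1 hc
    simp only [toContinuousLinearMap_apply, hE.map_mul_mul, map_mul]

/-- By Cauchy–Schwarz, `ρ` vanishes on every product with a factor `ι m`, `m x = 0`, on the left or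
on the right. Modulo such products `a` may be replaced by `k a k = k² E(a)`, and this by the scalar
`E(a)(x)`. -/
theorem eq_smul_evalState (hE : IsLocalExpectation ι E) {ρ : A →L[ℂ] ℂ}
    (hρ : IsPositiveFunctional ρ) {x : X}
    (h : ∀ m : C(X, ℂ), m x = 0 → ρ (ι (star m * m)) = 0) : ρ = ρ 1 • hE.evalState x := by
  have hz : ∀ m : C(X, ℂ), m x = 0 → ∀ c, ρ (ι m * c) = 0 ∧ ρ (c * ι m) = 0 := by
    intro m hm c
    have h1 : ρ (star (ι (star m)) * ι (star m)) = 0 := by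
      rw [← map_star, ← map_mul]
      exact h _ (by simp [hm])
    have h2 : ρ (star (ι m) * ι m) = 0 := by
      rw [← map_star, ← map_mul]
      exact h _ hm
    have h3 := (hρ.apply_star_mul_eq_zero h1 c).1
    have h4 := (hρ.apply_star_mul_eq_zero h2 (star c)).2
    rw [← map_star, star_star] at h3
    rw [star_star] at h4
    exact ⟨h3, h4⟩
  obtain ⟨k, -, -, hkx, hka⟩ := hE.compress x
  ext a
  -- The function `1 - k` vanishes at `x`, so `ρ` sees only the last summand.
  have e1 : a = ι (1 - k) * a + ι k * a * ι (1 - k) + ι k * a * ι k := by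
    simp only [map_sub, map_one]
    noncomm_ring
  have e2 : ι k * a * ι k = ι (k * k * E a - algebraMap ℂ C(X, ℂ) (E a x)) * 1 + E a x • 1 := by
    rw [hka, map_sub, mul_one, AlgHomClass.commutes, Algebra.algebraMap_eq_smul_one]
    abel
  have e3 := congrArg ρ (e1.trans (congrArg _ e2))
  simp only [_root_.map_add, _root_.map_smul] at e3
  rw [(hz (1 - k) (by simp [hkx]) _).1, (hz (1 - k) (by simp [hkx]) _).2,
    (hz (k * k * E a - algebraMap ℂ C(X, ℂ) (E a x)) (by simp [hkx]) _).1] at e3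
  rw [e3]
  simp [mul_comm]

theorem isState_evalState (hE : IsLocalExpectation ι E) (x : X) : IsState (hE.evalState x) := by
  have h1 : hE.evalState x 1 = 1 := by
    rw [evalState_apply, ← map_one ι, hE.apply_map, ContinuousMap.one_apply]
  have : Nontrivial A := by
    by_contra hA
    rw [not_nontrivial_iff_subsingleton] at hA
    rw [Subsingleton.elim (1 : A) 0, _root_.map_zero] at h1
    exact zero_ne_one h1
  refine ⟨fun a => hE.nonneg a x, le_antisymm ?_ ?_⟩
  · exact LinearMap.mkContinuous_norm_le _ zero_le_one _
  · simpa [h1] using (hE.evalState x).le_opNorm 1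

/-- On `C(X)` the functional `ρ` is dominated by evaluation at `x`, hence kills `m⋆ m` when `m x =
0`. With `ψ = evalState x` this gives purity; with `ρ = ψ` it gives uniqueness of the extension. -/
theorem eq_smul_evalState_of_le (hE : IsLocalExpectation ι E) {ρ ψ : A →L[ℂ] ℂ}
    (hρ : IsPositiveFunctional ρ) (hρψ : IsPositiveFunctional (ψ - ρ)) {x : X}
    (hψ : ∀ f, ψ (ι f) = f x) : ρ = ρ 1 • hE.evalState x := by
  refine hE.eq_smul_evalState hρ fun m hm => ?_
  have h1 := hρ (ι m)
  have h2 := hρψ (ι m)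
  rw [← map_star, ← map_mul] at h1 h2
  rw [sub_apply, hψ] at h2
  refine le_antisymm ?_ h1
  simpa [hm] using h2

theorem isPureState_evalState (hE : IsLocalExpectation ι E) (x : X) :
    IsPureState (hE.evalState x) := by
  refine ⟨hE.isState_evalState x, fun ρ hρ hρψ => ?_⟩
  have h1 := hρ 1
  have h2 := hρψ 1
  have h3 : hE.evalState x 1 = 1 := by
    rw [evalState_apply, ← map_one ι, hE.apply_map, ContinuousMap.one_apply]
  simp only [star_one, one_mul, sub_apply, h3, sub_nonneg] at h1 h2
  have h4 : ((ρ 1).re : ℂ) = ρ 1 := Complex.ext rfl (Complex.le_def.1 h1).2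
  refine ⟨(ρ 1).re, (Complex.le_def.1 h1).1, (Complex.le_def.1 h2).1, ?_⟩
  rw [h4]
  exact hE.eq_smul_evalState_of_le hρ hρψ fun f => by rw [evalState_apply, hE.apply_map]

theorem eq_evalState (hE : IsLocalExpectation ι E) {ψ : A →L[ℂ] ℂ} (hψ : IsPositiveFunctional ψ)
    {x : X} (h : ∀ f, ψ (ι f) = f x) : ψ = hE.evalState x := by
  have h1 : ψ 1 = 1 := by rw [← map_one ι, h, ContinuousMap.one_apply]
  rw [hE.eq_smul_evalState_of_le hψ (fun a => by simp) h, h1, one_smul]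

end IsLocalExpectation
end LocalExpectation

/-! ### Pure states of `C(X)` -/

section PureStates

variable {X : Type*} [TopologicalSpace X] [CompactSpace X]

/-- For `0 ≤ g ≤ 1` the functional `f ↦ φ (g f)` is positive and lies below `φ`, so purity makes it
a multiple of `φ`. Such `g` span `C(X)`. -/
theorem IsPureState.exists_mul_eq {φ : C(X, ℂ) →L[ℂ] ℂ} (hφ : IsPureState φ) (g : C(X, ℂ)) :
    ∃ t : ℂ, ∀ f, φ (g * f) = t * φ f := by
  have hg : g ∈ Submodule.span ℂ ({f : C(X, ℂ) | 0 ≤ f} ∩ Metric.closedBall 0 1) := by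
    rw [CStarAlgebra.span_nonneg_inter_closedBall zero_lt_one]
    trivial
  induction hg using Submodule.span_induction with
  | mem g hg =>
    obtain ⟨hg0, hg1⟩ := hg
    rw [mem_closedBall_zero_iff] at hg1
    have hg0' : ∀ x, 0 ≤ g x := fun x => hg0 x
    have hg1' : ∀ x, 0 ≤ (1 - g) x := by
      intro x
      have h1 := Complex.le_def.1 (hg0' x)
      have h2 := (ContinuousMap.norm_coe_le_norm g x).trans hg1
      rw [ContinuousMap.sub_apply, ContinuousMap.one_apply, sub_nonneg, Complex.le_def]
      exact ⟨(Complex.re_le_norm _).trans h2, h1.2.symm⟩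
    have hpos : ∀ k : C(X, ℂ), (∀ x, 0 ≤ k x) → ∀ f, 0 ≤ φ (k * (star f * f)) := by
      intro k hk f
      obtain ⟨l, rfl⟩ := ContinuousMap.exists_eq_star_mul_self hk
      have := hφ.1.1 (l * f)
      rwa [star_mul, show star f * star l * (l * f) = star l * l * (star f * f) by ring] at this
    obtain ⟨t, -, -, ht⟩ := hφ.2 (φ.comp (ContinuousLinearMap.mul ℂ C(X, ℂ) g))
      (fun f => hpos g hg0' f) (fun f => by
        have := hpos _ hg1' f
        rw [sub_mul, one_mul, map_sub] at this
        simpa using this)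
    exact ⟨t, fun f => DFunLike.congr_fun ht f⟩
  | zero => exact ⟨0, by simp⟩
  | add a b _ _ ha hb =>
    obtain ⟨s, hs⟩ := ha
    obtain ⟨t, ht⟩ := hb
    exact ⟨s + t, fun f => by rw [add_mul, map_add, hs, ht, add_mul]⟩
  | smul c a _ ha =>
    obtain ⟨s, hs⟩ := ha
    exact ⟨c * s, fun f => by rw [smul_mul_assoc, map_smul, hs, smul_eq_mul, mul_assoc]⟩

variable [T2Space X]

theorem ContinuousMap.exists_eq_eval_of_map_mul {χ : C(X, ℂ) →L[ℂ] ℂ} (h1 : χ 1 = 1)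
    (hmul : ∀ f g, χ (f * g) = χ f * χ g) : ∃ x, ∀ f, χ f = f x := by
  obtain ⟨x, hx⟩ := (WeakDual.CharacterSpace.continuousMapEval_bijective (X := X) (𝕜 := ℂ)).2
    ⟨χ, fun h => by
      have h' : χ = 0 := h
      rw [h'] at h1
      exact zero_ne_one h1, hmul⟩
  exact ⟨x, fun f => (DFunLike.congr_fun hx f).symm⟩

/-- Pure states of `C(X)` are point evaluations. -/
theorem IsPureState.exists_eq_eval {φ : C(X, ℂ) →L[ℂ] ℂ} (hφ : IsPureState φ) :
    ∃ x, ∀ f, φ f = f x := by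
  choose t ht using hφ.exists_mul_eq
  have ht1 : ∀ g, φ g = t g * φ 1 := fun g => by simpa using ht g 1
  have hc : φ 1 ≠ 0 := by
    intro h0
    have : φ = 0 := by
      ext g
      rw [ht1, h0, mul_zero, zero_apply]
    have h := hφ.1.2
    rw [this, norm_zero] at h
    exact zero_ne_one h
  -- Since `φ (g f) = t g * φ f` and `φ g = t g * φ 1`, the normalized functional is multiplicative,
  -- hence a point evaluation. It remains to see that `φ 1 = 1`, which follows from norm one and
  -- positivity.
  obtain ⟨x, hx⟩ := ContinuousMap.exists_eq_eval_of_map_mul (χ := (φ 1)⁻¹ • φ)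
    (by simp [hc]) (fun f g => by
      simp only [smul_apply, smul_eq_mul]
      rw [ht, ht1 f]
      field_simp)
  have hx' : ∀ f, φ f = φ 1 * f x := fun f => by
    rw [← hx f, smul_apply, smul_eq_mul, mul_inv_cancel_left₀ hc]
  have hnorm : ‖φ 1‖ = 1 := by
    apply le_antisymm
    · have := φ.le_opNorm 1
      have h1 : ‖(1 : C(X, ℂ))‖ ≤ 1 := (ContinuousMap.norm_le _ zero_le_one).2 fun y => by simp
      rw [hφ.1.2, one_mul] at this
      exact this.trans h1
    · rw [← hφ.1.2]
      refine φ.opNorm_le_bound (norm_nonneg _) fun f => ?_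
      rw [hx', norm_mul]
      gcongr
      exact ContinuousMap.norm_coe_le_norm f x
  have hpos : 0 ≤ φ 1 := by simpa using hφ.1.1 1
  have h1 : φ 1 = 1 := by
    rw [Complex.eq_coe_norm_of_nonneg hpos, hnorm, Complex.ofReal_one]
  exact ⟨x, fun f => by rw [hx', h1, one_mul]⟩

end PureStates

/-! ### Subalgebras isomorphic to `C(X)`: pure states and spectrum -/

section Range

variable {X : Type*} [TopologicalSpace X] {A : Type*} [CStarAlgebra A]
  {ι : C(X, ℂ) →⋆ₐ[ℂ] A} {B : NonUnitalStarSubalgebra ℂ A}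

/-- An injective `ι : C(X) → A` with range `B`, as an isomorphism onto `B`. -/
noncomputable def rangeEquiv (hι : Function.Injective ι) (hB : ∀ a, a ∈ B ↔ ∃ f, ι f = a) :
    C(X, ℂ) ≃⋆ₐ[ℂ] B where
  toEquiv := Equiv.ofBijective (fun f => (⟨ι f, (hB _).2 ⟨f, rfl⟩⟩ : B))
    ⟨fun _ _ h => hι (Subtype.ext_iff.1 h), fun b => by
      obtain ⟨f, hf⟩ := (hB b).1 b.2
      exact ⟨f, Subtype.ext hf⟩⟩
  map_mul' f g := Subtype.ext (map_mul ι f g)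
  map_add' f g := Subtype.ext (map_add ι f g)
  map_star' f := Subtype.ext (map_star ι f)
  map_smul' c f := Subtype.ext (map_smul ι c f)

@[simp]
theorem coe_rangeEquiv (hι : Function.Injective ι) (hB : ∀ a, a ∈ B ↔ ∃ f, ι f = a)
    (f : C(X, ℂ)) : (rangeEquiv hι hB f : A) = ι f := rfl

variable [CompactSpace X]

/-- `rangeEquiv` as an isometry. -/
noncomputable def rangeIsometry (hι : Function.Injective ι) (hB : ∀ a, a ∈ B ↔ ∃ f, ι f = a) :
    C(X, ℂ) ≃ₗᵢ[ℂ] B where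
  toLinearEquiv := (rangeEquiv hι hB).toEquiv.toLinearEquiv
    ⟨map_add (rangeEquiv hι hB), map_smul (rangeEquiv hι hB)⟩
  norm_map' f := NonUnitalStarAlgHom.norm_map ι hι f

theorem rangeIsometry_apply (hι : Function.Injective ι) (hB : ∀ a, a ∈ B ↔ ∃ f, ι f = a)
    (f : C(X, ℂ)) : rangeIsometry hι hB f = rangeEquiv hι hB f := rfl

variable [T2Space X]

/-- Purity is expressed by the norm and by the squares `a⋆ a` alone, so it passes through the
isometric ⋆-isomorphism with `C(X)`. -/
theorem IsPureState.exists_eq_eval_of_range (hι : Function.Injective ι)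
    (hB : ∀ a, a ∈ B ↔ ∃ f, ι f = a) {φ : B →L[ℂ] ℂ} (hφ : IsPureState φ) :
    ∃ x, ∀ f, φ (rangeEquiv hι hB f) = f x := by
  set L := rangeIsometry hι hB with hL
  have hLs : ∀ a : B, L.symm (star a * a) = star (L.symm a) * L.symm a := by
    intro a
    apply L.injective
    rw [L.apply_symm_apply, hL, rangeIsometry_apply, map_mul, map_star, ← rangeIsometry_apply,
      ← hL, L.apply_symm_apply]
  have hLm : ∀ f, L (star f * f) = star (L f) * L f := by
    intro f
    rw [hL, rangeIsometry_apply, map_mul, map_star, ← rangeIsometry_apply]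
  have hpure : IsPureState (φ.comp (L : C(X, ℂ) →L[ℂ] B)) := by
    refine ⟨⟨fun f => ?_, ?_⟩, fun ψ hψ hψφ => ?_⟩
    · have := hφ.1.1 (L f)
      rwa [← hLm] at this
    · exact (ContinuousLinearMap.opNorm_comp_linearIsometryEquiv φ L).trans hφ.1.2
    · obtain ⟨t, ht0, ht1, ht⟩ := hφ.2 (ψ.comp (L.symm : B →L[ℂ] C(X, ℂ)))
        (fun a => by
          have := hψ (L.symm a)
          rwa [← hLs] at this)
        (fun a => by
          have := hψφ (L.symm a)
          rw [← hLs] at this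
          simpa using this)
      refine ⟨t, ht0, ht1, ?_⟩
      ext f
      have := DFunLike.congr_fun ht (L f)
      simpa using this
  obtain ⟨x, hx⟩ := hpure.exists_eq_eval
  exact ⟨x, fun f => hx f⟩

/-- The spectrum of a subalgebra isomorphic to `C(X)`. -/
theorem exists_homeomorph_characterSpace (hι : Function.Injective ι)
    (hB : ∀ a, a ∈ B ↔ ∃ f, ι f = a) : ∃ h : X ≃ₜ WeakDual.characterSpace ℂ B,
      ∀ x f, h x (rangeEquiv hι hB f) = f x := by
  set e := rangeEquiv hι hB
  set L := rangeIsometry hι hB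
  have hLe : ∀ b, L.symm b = e.symm b := fun b => rfl
  let ev : X → B →L[ℂ] ℂ := fun x =>
    (ContinuousMap.evalCLM ℂ x).comp (L.symm : B →L[ℂ] C(X, ℂ))
  have hev : ∀ x b, ev x b = e.symm b x := fun x b => rfl
  let F : X → WeakDual.characterSpace ℂ B := fun x => ⟨ev x, fun h0 => by
      have : ev x (e 1) = 0 := DFunLike.congr_fun h0 (e 1)
      rw [hev, e.symm_apply_apply] at this
      exact one_ne_zero this, fun a b => by
      change ev x (a * b) = ev x a * ev x b
      rw [hev, hev, hev, map_mul, ContinuousMap.mul_apply]⟩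
  have hF : ∀ x b, F x b = e.symm b x := fun x b => rfl
  have hcont : Continuous F := by
    refine Continuous.subtype_mk (WeakDual.continuous_of_continuous_eval fun b => ?_) _
    exact (e.symm b).continuous
  have hinj : Function.Injective F := by
    intro x y hxy
    by_contra hne
    have h1 := (WeakDual.CharacterSpace.continuousMapEval_bijective (X := X) (𝕜 := ℂ)).1.ne hne
    refine h1 (WeakDual.CharacterSpace.ext fun f => ?_)
    have := DFunLike.congr_fun hxy (e f)
    rw [hF, hF, e.symm_apply_apply] at this
    exact this
  have hsurj : Function.Surjective F := by
    intro χ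
    have hχ : ∀ a b : B, χ (a * b) = χ a * χ b := fun a b => map_mul χ a b
    let χ' : B →L[ℂ] ℂ := WeakDual.CharacterSpace.toCLM χ
    -- The value at the idempotent `e 1` is `0` or `1`; as `e 1` is a unit for `B`, the value `0`
    -- would make `χ` zero.
    have h1 : χ (e 1) = 1 := by
      by_contra hne
      have h2 : χ (e 1) * χ (e 1) = χ (e 1) := by rw [← hχ, ← map_mul, one_mul]
      have h3 : χ (e 1) = 0 := by
        by_contra h4
        exact hne (mul_right_cancel₀ h4 (by rw [h2, one_mul]))
      refine χ.2.1 ?_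
      refine DFunLike.ext _ _ fun b => ?_
      change χ b = 0
      rw [← e.apply_symm_apply b, ← one_mul (e.symm b), map_mul, hχ, h3, zero_mul]
    obtain ⟨x, hx⟩ := ContinuousMap.exists_eq_eval_of_map_mul
      (χ := χ'.comp (L : C(X, ℂ) →L[ℂ] B)) h1 (fun f g => by
        change χ (e (f * g)) = χ (e f) * χ (e g)
        rw [map_mul, hχ])
    refine ⟨x, WeakDual.CharacterSpace.ext fun b => ?_⟩
    rw [hF, ← hx]
    change χ (e (e.symm b)) = χ b
    rw [e.apply_symm_apply]
  refine ⟨Continuous.homeoOfEquivCompactToT2 (f := Equiv.ofBijective F ⟨hinj, hsurj⟩) hcont,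
    fun x f => ?_⟩
  change F x (e f) = f x
  rw [hF, e.symm_apply_apply]

end Range

/-! ### Free covariant systems and their diagonal subalgebras -/

section FreeCovariantSystem

variable {X G : Type*} [TopologicalSpace X] [Fintype G]
  {A : Type*} [CStarAlgebra A]

/-- `A` is spanned over a copy `ι (C(X))` of `C(X)` by unitaries `u g` implementing homeomorphisms
`σ g` of `X`, the values of which at each point are distinct for distinct `g`; the unitary
`u o` is the unit, and `c g a` is a coefficient of `a` at `u g`. -/
structure IsFreeCovariantSystem (ι : C(X, ℂ) →⋆ₐ[ℂ] A) (u : G → A) (σ : G → X ≃ₜ X) (o : G)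
    (c : G → A → C(X, ℂ)) : Prop where
  injective : Function.Injective ι
  star_mul_self : ∀ g, star (u g) * u g = 1
  mul_star_self : ∀ g, u g * star (u g) = 1
  covariant : ∀ g (f : C(X, ℂ)), u g * ι f = ι (f.comp (σ g)) * u g
  free : ∀ x, Function.Injective fun g => σ g x
  unitary_one : u o = 1
  homeomorph_one : ∀ x, σ o x = x
  expansion : ∀ a, a = ∑ g, ι (c g a) * u g

variable {ι : C(X, ℂ) →⋆ₐ[ℂ] A} {u : G → A} {σ : G → X ≃ₜ X} {o : G} {c : G → A → C(X, ℂ)}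

/-- A bump function at `x` the supports of which under finitely many maps moving `x` are disjoint
from its own. -/
theorem ContinuousMap.exists_bump_mul_comp_eq_zero [CompactSpace X] [T2Space X]
    {τ : G → X ≃ₜ X} {x : X} {s : Set G}
    (hτ : ∀ g ∈ s, τ g x ≠ x) :
    ∃ h : C(X, ℂ), star h = h ∧ ‖h‖ ≤ 1 ∧ h x = 1 ∧ ∀ g ∈ s, h * h.comp (τ g) = 0 := by
  have hV : ∀ g, ∃ V : Set X, IsOpen V ∧ x ∈ V ∧ (g ∈ s → ∀ y ∈ V, τ g y ∉ V) := by
    intro g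
    by_cases hg : g ∈ s
    · obtain ⟨U, W, hU, hW, hxU, hxW, hUW⟩ := t2_separation (hτ g hg)
      refine ⟨τ g ⁻¹' U ∩ W, (hU.preimage (τ g).continuous).inter hW, ⟨hxU, hxW⟩, ?_⟩
      exact fun _ y hy hy' => Set.disjoint_left.1 hUW hy.1 hy'.2
    · exact ⟨Set.univ, isOpen_univ, trivial, fun h => absurd h hg⟩
  choose V hVo hxV hV using hV
  obtain ⟨f, hf0, hf1, hf⟩ := exists_continuous_zero_one_of_isClosed
    (isOpen_iInter_of_finite hVo).isClosed_compl (isClosed_singleton (x := x))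
    (by simpa using hxV)
  refine ⟨⟨fun y => (f y : ℂ), by fun_prop⟩, ?_, ?_, ?_, fun g hg => ?_⟩
  · ext y
    simp
  · refine (ContinuousMap.norm_le _ zero_le_one).2 fun y => ?_
    rw [coe_mk, Complex.norm_real, Real.norm_eq_abs, abs_of_nonneg (hf y).1]
    exact (hf y).2
  · rw [coe_mk, hf1 rfl]
    simp
  · ext y
    simp only [mul_apply, coe_mk, comp_apply, zero_apply, mul_eq_zero, Complex.ofReal_eq_zero]
    by_cases hy : y ∈ V g
    · right
      exact hf0 fun h => hV g hg y hy (Set.mem_iInter.1 h g)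
    · left
      exact hf0 fun h => hy (Set.mem_iInter.1 h g)

namespace IsFreeCovariantSystem

/-- Moving `h` across `u g` turns the compression of `ι (c g a) * u g` into a multiple of `h * (h ∘
σ g)`. Freeness gives `σ g x ≠ x` for `g ≠ o`, so a bump function at `x` can be chosen to make these
products zero. -/
theorem isLocalExpectation [CompactSpace X] [T2Space X] (H : IsFreeCovariantSystem ι u σ o c) :
    IsLocalExpectation ι (c o) where
  injective := H.injective
  compress x := by
    obtain ⟨h, hs, hn, hx, hg⟩ := ContinuousMap.exists_bump_mul_comp_eq_zero (τ := σ) (x := x)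
      (s := {g | g ≠ o}) (fun g hg hgx => hg (H.free x (hgx.trans (H.homeomorph_one x).symm)))
    refine ⟨h, hs, hn, hx, fun a => ?_⟩
    have hterm : ∀ g, ι h * (ι (c g a) * u g) * ι h = ι (h * h.comp (σ g) * c g a) * u g := by
      intro g
      rw [mul_assoc, mul_assoc, H.covariant, ← mul_assoc, ← mul_assoc, ← map_mul, ← map_mul,
        mul_right_comm]
    conv_lhs => rw [H.expansion a]
    rw [Finset.mul_sum, Finset.sum_mul, Finset.sum_eq_single o]
    · rw [hterm, H.unitary_one, mul_one]
      congr 3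
      ext y
      simp [H.homeomorph_one]
    · intro g _ hgo
      rw [hterm, hg g hgo, zero_mul, map_zero, zero_mul]
    · simp

theorem star_mul_map (H : IsFreeCovariantSystem ι u σ o c) (g : G) (f : C(X, ℂ)) :
    star (u g) * ι f = ι (f.comp (σ g).symm) * star (u g) := by
  have h := H.covariant g (f.comp (σ g).symm)
  rw [show (f.comp ((σ g).symm : C(X, X))).comp (σ g : C(X, X)) = f by ext; simp] at h
  calc star (u g) * ι f = star (u g) * (ι f * u g) * star (u g) := by
        rw [mul_assoc, mul_assoc, H.mul_star_self, mul_one]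
    _ = ι (f.comp (σ g).symm) * star (u g) := by
        rw [← h, ← mul_assoc, H.star_mul_self, one_mul]

theorem mul_map_mul_star (H : IsFreeCovariantSystem ι u σ o c) (g : G) (f : C(X, ℂ)) :
    u g * ι f * star (u g) = ι (f.comp (σ g)) := by
  rw [H.covariant, mul_assoc, H.mul_star_self, mul_one]

theorem star_mul_map_mul (H : IsFreeCovariantSystem ι u σ o c) (g : G) (f : C(X, ℂ)) :
    star (u g) * ι f * u g = ι (f.comp (σ g).symm) := by
  rw [H.star_mul_map, mul_assoc, H.star_mul_self, mul_one]

variable {B : NonUnitalStarSubalgebra ℂ A}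

theorem unitary_mem_normalizerSet (H : IsFreeCovariantSystem ι u σ o c)
    (hB : ∀ a, a ∈ B ↔ ∃ f, ι f = a) (g : G) : u g ∈ normalizerSet B := by
  intro b hb
  obtain ⟨f, rfl⟩ := (hB b).1 hb
  rw [H.mul_map_mul_star, H.star_mul_map_mul]
  exact ⟨(hB _).2 ⟨_, rfl⟩, (hB _).2 ⟨_, rfl⟩⟩

variable [CompactSpace X] [T2Space X]

theorem isCartan (H : IsFreeCovariantSystem ι u σ o c) (hB : ∀ a, a ∈ B ↔ ∃ f, ι f = a) :
    IsCartan B where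
  isClosed := by
    have : (B : Set A) = Set.range ι := Set.ext hB
    rw [this]
    exact (NonUnitalStarAlgHom.isometry ι H.injective).isClosedEmbedding.isClosed_range
  commutative b hb b' hb' := by
    obtain ⟨f, rfl⟩ := (hB b).1 hb
    obtain ⟨f', rfl⟩ := (hB b').1 hb'
    rw [← map_mul, mul_comm, map_mul]
  approximateUnit := ⟨pure 1, Filter.IsApproximateUnit.pure_one A,
    Filter.eventually_pure.2 ((hB 1).2 ⟨1, map_one ι⟩)⟩
  maximal C _ hC hBC := by
    refine le_antisymm (fun a ha => (hB a).2 ⟨c o a, ?_⟩) hBC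
    exact (H.isLocalExpectation.eq_of_commute fun f => hC _ (hBC ((hB _).2 ⟨f, rfl⟩)) _ ha).symm
  regular := by
    refine eq_top_iff.2 fun a _ => ?_
    refine NonUnitalStarSubalgebra.le_topologicalClosure _ ?_
    -- Regularity already holds before closure: the coefficients lie in `B`, hence normalize it, and
    -- so do the unitaries.
    rw [H.expansion a]
    refine sum_mem fun g _ => mul_mem ?_ ?_
    · refine NonUnitalStarAlgebra.subset_adjoin ℂ _ fun b hb => ?_
      have h1 : ι (c g a) ∈ B := (hB _).2 ⟨_, rfl⟩
      exact ⟨mul_mem (mul_mem h1 hb) (star_mem h1), mul_mem (mul_mem (star_mem h1) hb) h1⟩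
    · exact NonUnitalStarAlgebra.subset_adjoin ℂ _ (H.unitary_mem_normalizerSet hB g)
  expectation := ⟨_, H.isLocalExpectation.isConditionalExpectation hB, fun a ha =>
    H.isLocalExpectation.faithful (H.injective (by rw [map_zero]; exact ha))⟩

/-- A pure state of `B` is evaluation at some `x`, and `evalState x` is its only positive extension,
which is itself pure. -/
theorem _root_.IsLocalExpectation.hasUniqueExtension {E : A → C(X, ℂ)}
    (hE : IsLocalExpectation ι E) (hB : ∀ a, a ∈ B ↔ ∃ f, ι f = a) : HasUniqueExtension B := by
  intro φ hφ
  obtain ⟨x, hx⟩ := hφ.exists_eq_eval_of_range hE.injective hB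
  refine ⟨hE.evalState x, ⟨hE.isPureState_evalState x, fun b => ?_⟩, fun ψ hψ => ?_⟩
  · obtain ⟨f, rfl⟩ := EquivLike.surjective (rangeEquiv hE.injective hB) b
    rw [hx, coe_rangeEquiv, IsLocalExpectation.evalState_apply, hE.apply_map]
  · refine hE.eq_evalState hψ.1.1.1 fun f => ?_
    rw [← hx, ← hψ.2, coe_rangeEquiv]

theorem isDiagonalSubalgebra (H : IsFreeCovariantSystem ι u σ o c)
    (hB : ∀ a, a ∈ B ↔ ∃ f, ι f = a) : IsDiagonalSubalgebra B :=
  ⟨H.isCartan hB, H.isLocalExpectation.hasUniqueExtension hB⟩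

/-- The relation on the spectrum is the orbit relation of the homeomorphisms. -/
theorem spectralRelation_iff (H : IsFreeCovariantSystem ι u σ o c)
    (hB : ∀ a, a ∈ B ↔ ∃ f, ι f = a) {h : X ≃ₜ WeakDual.characterSpace ℂ B}
    (hh : ∀ x f, h x (rangeEquiv H.injective hB f) = f x) (x y : X) :
    spectralRelation B (h x) (h y) ↔ ∃ g, σ g y = x := by
  set E := c o
  have hE : IsLocalExpectation ι E := H.isLocalExpectation
  have hval : ∀ z (b : B), h z b = E b z := by
    intro z b
    obtain ⟨f, rfl⟩ := EquivLike.surjective (rangeEquiv H.injective hB) b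
    rw [hh, coe_rangeEquiv, hE.apply_map]
  constructor
  · rintro ⟨v, hv, s, hs, hs0, hvb⟩
    by_contra hne
    push Not at hne
    -- If `y` is not one of the finitely many points `(σ g)⁻¹ x`, some `k` is `1` at `y` and `0` at
    -- all of them. The relation then gives `x (v⋆ k v) = x (v⋆ v) ≠ 0`.
    obtain ⟨f, hf0, hf1, -⟩ := exists_continuous_zero_one_of_isClosed
      (Set.finite_range fun g => (σ g).symm x).isClosed (isClosed_singleton (x := y))
      (by
        rw [Set.disjoint_singleton_right]
        rintro ⟨g, hg⟩
        exact hne g (by rw [← hg]; simp))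
    let k : C(X, ℂ) := ⟨fun z => (f z : ℂ), by fun_prop⟩
    have hk : ∀ g, k ((σ g).symm x) = 0 := fun g => by
      change ((f _ : ℝ) : ℂ) = 0
      rw [hf0 ⟨g, rfl⟩]
      simp
    have hky : k y = 1 := by
      change ((f _ : ℝ) : ℂ) = 1
      rw [hf1 rfl]
      simp
    have hkey := hvb (rangeEquiv H.injective hB k)
    rw [hh, hky, one_mul, hval] at hkey
    refine hs0 (hkey.symm.trans ?_)
    change E (star v * ι k * v) x = 0
    -- Expanding only the right-hand `v` and moving `k` past `u g` leaves the factor `k ∘ (σ g)⁻¹`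
    -- on the right of each term, where it comes out of `E` and vanishes at `x`.
    have hexp : star v * ι k * v
        = ∑ g, star v * u g * ι ((k * c g v).comp (σ g).symm) := by
      refine (congrArg (star v * ι k * ·) (H.expansion v)).trans ?_
      rw [Finset.mul_sum]
      refine Finset.sum_congr rfl fun g _ => ?_
      rw [mul_assoc _ (u g), H.covariant,
        show ((k * c g v).comp ((σ g).symm : C(X, X))).comp (σ g : C(X, X)) = k * c g v by
          ext; simp, map_mul]
      simp only [mul_assoc]
    rw [← hE.evalState_apply, hexp, map_sum]
    refine Finset.sum_eq_zero fun g _ => ?_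
    rw [hE.evalState_apply, hE.map_mul_right]
    simp [hk]
  · rintro ⟨g, rfl⟩
    have h1 : (1 : A) ∈ B := (hB 1).2 ⟨1, map_one ι⟩
    have h11 : h (σ g y) ⟨1, h1⟩ = 1 := by
      rw [hval]
      change E 1 _ = 1
      rw [← map_one ι, hE.apply_map, ContinuousMap.one_apply]
    -- The unitary `u g` itself relates the two points: `(u g)⋆ f (u g) = f ∘ (σ g)⁻¹` takes at `σ g
    -- y` the value `f y`.
    refine ⟨u g, H.unitary_mem_normalizerSet hB g, ⟨1, h1⟩, (H.star_mul_self g).symm, ?_, ?_⟩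
    · rw [h11]
      exact one_ne_zero
    · intro b
      obtain ⟨f, rfl⟩ := EquivLike.surjective (rangeEquiv H.injective hB) b
      rw [h11, mul_one, hh, hval]
      change E (star (u g) * ι f * u g) _ = _
      rw [H.star_mul_map_mul, hE.apply_map]
      simp

end IsFreeCovariantSystem

/-- This makes the results on `B₂` independent of the choice of `Φ`; it also serves to transport
`B₁` by an automorphism. -/
theorem IsFreeCovariantSystem.map {A' : Type*} [CStarAlgebra A']
    (H : IsFreeCovariantSystem ι u σ o c) (Ψ : A ≃⋆ₐ[ℂ] A') {ι' : C(X, ℂ) →⋆ₐ[ℂ] A'}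
    (hι' : ∀ f, ι' f = Ψ (ι f)) :
    IsFreeCovariantSystem ι' (fun g => Ψ (u g)) σ o fun g a => c g (Ψ.symm a) where
  injective f g hfg := H.injective (EquivLike.injective Ψ (by rw [← hι', ← hι', hfg]))
  star_mul_self g := by rw [← map_star, ← map_mul, H.star_mul_self, map_one]
  mul_star_self g := by rw [← map_star, ← map_mul, H.mul_star_self, map_one]
  covariant g f := by rw [hι', hι', ← map_mul, H.covariant, map_mul]
  free := H.free
  unitary_one := by rw [H.unitary_one, map_one]
  homeomorph_one := H.homeomorph_one
  expansion a := by
    apply EquivLike.injective Ψ.symm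
    rw [map_sum]
    conv_lhs => rw [H.expansion (Ψ.symm a)]
    refine Finset.sum_congr rfl fun g _ => ?_
    rw [hι', ← map_mul, StarAlgEquiv.symm_apply_apply]

end FreeCovariantSystem

/-- The quotient of a compact space by the fibres of a continuous surjection. -/
theorem nonempty_quot_homeomorph {X Y Z : Type*} [TopologicalSpace X] [CompactSpace X]
    [TopologicalSpace Y] [TopologicalSpace Z] [T2Space Z] (h : X ≃ₜ Y) {q : X → Z}
    (hq : Continuous q) (hqs : Function.Surjective q) {r : Y → Y → Prop}
    (hr : ∀ x y, r (h x) (h y) ↔ q x = q y) : Nonempty (Quot r ≃ₜ Z) := by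
  have hr' : ∀ a b, r a b ↔ q (h.symm a) = q (h.symm b) := fun a b => by
    rw [← hr, h.apply_symm_apply, h.apply_symm_apply]
  have : CompactSpace Y := h.compactSpace
  let F : Quot r → Z := Quot.lift (fun a => q (h.symm a)) fun a b hab => (hr' a b).1 hab
  have hF : Function.Bijective F := by
    constructor
    · rintro ⟨a⟩ ⟨b⟩ hab
      exact Quot.sound ((hr' a b).2 hab)
    · intro z
      obtain ⟨x, rfl⟩ := hqs z
      exact ⟨Quot.mk r (h x), by simp [F]⟩
  exact ⟨Continuous.homeoOfEquivCompactToT2 (f := Equiv.ofBijective F hF)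
    (continuous_quot_lift _ (hq.comp h.symm.continuous))⟩

theorem CStarMatrix.sum_apply {ι m n A : Type*} [AddCommMonoid A] (s : Finset ι)
    (f : ι → CStarMatrix m n A) (i : m) (j : n) : (∑ k ∈ s, f k) i j = ∑ k ∈ s, f k i j := by
  induction s using Finset.cons_induction with
  | empty => rfl
  | cons k s hk ih => rw [Finset.sum_cons, Finset.sum_cons, CStarMatrix.add_apply, ih]

/-! ### Diagonal matrices over `C(𝕋)` as a free covariant system -/

section CircleDiagonal

variable {n : ℕ}

/-- Functions on `𝕋 × {1, …, n}` are families of functions on `𝕋`. -/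
noncomputable def circleProdEquiv (n : ℕ) : (Fin n → C(Circle, ℂ)) ≃⋆ₐ[ℂ] C(Circle × Fin n, ℂ) where
  toFun f := ⟨fun p => f p.2 p.1,
    continuous_prod_of_discrete_right.2 fun i => (f i).continuous⟩
  invFun F i := ⟨fun z => F (z, i), by fun_prop⟩
  left_inv _ := rfl
  right_inv _ := rfl
  map_mul' _ _ := rfl
  map_add' _ _ := rfl
  map_star' _ := rfl
  map_smul' _ _ := rfl

@[simp]
theorem circleProdEquiv_apply (f : Fin n → C(Circle, ℂ)) (p : Circle × Fin n) :
    circleProdEquiv n f p = f p.2 p.1 := rfl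

@[simp]
theorem circleProdEquiv_symm_apply (F : C(Circle × Fin n, ℂ)) (i : Fin n) (z : Circle) :
    (circleProdEquiv n).symm F i z = F (z, i) := rfl

/-- Diagonal matrices over `C(𝕋)`. -/
noncomputable def diagonalHom (n : ℕ) : C(Circle × Fin n, ℂ) →⋆ₐ[ℂ] CircleMatrixAlg n where
  toFun F := CStarMatrix.ofMatrix (Matrix.diagonal ((circleProdEquiv n).symm F))
  map_one' := by
    ext i j z
    by_cases h : i = j <;> simp [h, CStarMatrix.one_apply]
  map_mul' F F' := by
    ext i j z
    by_cases h : i = j <;> simp [h, CStarMatrix.mul_apply, Matrix.diagonal]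
  map_zero' := by
    ext i j z
    by_cases h : i = j <;> simp [h]
  map_add' F F' := by
    ext i j z
    by_cases h : i = j <;> simp [h]
  commutes' r := by
    ext i j z
    by_cases h : i = j <;> simp [h, CStarMatrix.algebraMap_apply, Algebra.algebraMap_eq_smul_one]
  map_star' F := by
    ext i j z
    by_cases h : i = j
    · simp [h, CStarMatrix.star_apply]
    · simp [h, Ne.symm h, CStarMatrix.star_apply]

theorem diagonalHom_apply (F : C(Circle × Fin n, ℂ)) (i j : Fin n) (z : Circle) :
    diagonalHom n F i j z = if i = j then F (z, i) else 0 := by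
  by_cases h : i = j <;> simp [h, diagonalHom]

theorem elementaryTensor_apply (f : C(Circle, ℂ)) (m : MatrixAlg n) (i j : Fin n) :
    elementaryTensor f m i j = m i j • f := rfl

theorem diagonalHom_mul_apply (F : C(Circle × Fin n, ℂ)) (a : CircleMatrixAlg n) (i j : Fin n)
    (z : Circle) : (diagonalHom n F * a) i j z = F (z, i) * a i j z := by
  simp only [CStarMatrix.mul_apply, ContinuousMap.coe_sum, Finset.sum_apply,
    ContinuousMap.mul_apply, diagonalHom_apply]
  rw [Finset.sum_eq_single i]
  · simp
  · intro l _ hl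
    simp [hl.symm]
  · simp

/-- Cyclic permutation matrices. -/
noncomputable def cyclicMatrix (k : Fin n) : CircleMatrixAlg n :=
  CStarMatrix.ofMatrix fun i j => if j = i + k then 1 else 0

theorem cyclicMatrix_apply (k i j : Fin n) :
    cyclicMatrix k i j = if j = i + k then 1 else 0 := rfl

variable [NeZero n]

/-- The cyclic rotations of the second coordinate of `𝕋 × {1, …, n}`. -/
noncomputable def sheetRotation (k : Fin n) : Circle × Fin n ≃ₜ Circle × Fin n :=
  (Homeomorph.refl Circle).prodCongr (Equiv.addRight k).toHomeomorphOfDiscrete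

@[simp]
theorem sheetRotation_apply (k : Fin n) (p : Circle × Fin n) :
    sheetRotation k p = (p.1, p.2 + k) := rfl

/-- A matrix is the sum of its cyclic diagonals `j = i + k`, taken modulo `n`, and each of these is
a diagonal matrix times a cyclic permutation matrix. -/
theorem isFreeCovariantSystem_diagonalHom (n : ℕ) [NeZero n] :
    IsFreeCovariantSystem (diagonalHom n) cyclicMatrix sheetRotation 0
      fun k a => circleProdEquiv n fun i => a i (i + k) where
  injective F F' h := by
    ext ⟨z, i⟩
    have := congrArg (fun M : CircleMatrixAlg n => M i i z) h
    simpa [diagonalHom_apply] using this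
  star_mul_self k := by
    ext i j z
    simp only [CStarMatrix.mul_apply, CStarMatrix.star_apply, cyclicMatrix_apply,
      CStarMatrix.one_apply]
    rw [Finset.sum_eq_single (i - k)]
    · by_cases h : i = j <;> simp [h, eq_comm]
    · intro l _ hl
      have : i ≠ l + k := fun h => hl (by rw [h, add_sub_cancel_right])
      simp [this]
    · simp
  mul_star_self k := by
    ext i j z
    simp only [CStarMatrix.mul_apply, CStarMatrix.star_apply, cyclicMatrix_apply,
      CStarMatrix.one_apply]
    rw [Finset.sum_eq_single (i + k)]
    · by_cases h : i = j <;> simp [h]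
    · intro l _ hl
      simp [hl]
    · simp
  covariant k F := by
    ext i j z
    simp only [diagonalHom_mul_apply]
    simp only [CStarMatrix.mul_apply, cyclicMatrix_apply, ContinuousMap.coe_sum, Finset.sum_apply,
      ContinuousMap.mul_apply, diagonalHom_apply, ContinuousMap.comp_apply]
    rw [Finset.sum_eq_single (i + k)]
    · by_cases h : j = i + k <;> simp [h, eq_comm]
    · intro l _ hl
      simp [hl]
    · simp
  free p k l h := by
    have := congrArg Prod.snd h
    simpa using this
  unitary_one := by
    ext i j z
    simp [cyclicMatrix_apply, CStarMatrix.one_apply, eq_comm]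
  homeomorph_one p := by simp
  expansion a := by
    ext i j z
    rw [CStarMatrix.sum_apply, ContinuousMap.coe_sum, Finset.sum_apply, Finset.sum_eq_single (j - i)]
    · simp [diagonalHom_mul_apply, cyclicMatrix_apply]
    · intro k _ hk
      have : j ≠ i + k := fun h => hk (by rw [h, add_sub_cancel_left])
      simp [diagonalHom_mul_apply, cyclicMatrix_apply, this]
    · simp

/-- The range of `diagonalHom` is closed and contains the generators; conversely a diagonal matrix
is the finite sum of the tensors `F_i ⊗ e_ii`, so taking the closure adds nothing. -/
theorem mem_circleDiagonal_iff (a : CircleMatrixAlg n) :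
    a ∈ circleDiagonal n ↔ ∃ F, diagonalHom n F = a := by
  constructor
  · intro ha
    have hcl : IsClosed (Set.range (diagonalHom n)) :=
      (NonUnitalStarAlgHom.isometry (diagonalHom n)
        (isFreeCovariantSystem_diagonalHom n).injective).isClosedEmbedding.isClosed_range
    have hle : circleDiagonal n ≤ NonUnitalStarAlgHom.range (diagonalHom n) := by
      refine NonUnitalStarSubalgebra.topologicalClosure_minimal _
        (NonUnitalStarAlgebra.adjoin_le ?_) hcl
      rintro _ ⟨f, d, hd, rfl⟩
      refine ⟨circleProdEquiv n fun i => d i i • f, ?_⟩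
      ext i j z
      change diagonalHom n _ i j z = _
      by_cases h : i = j
      · subst h
        simp [diagonalHom_apply, elementaryTensor_apply]
      · simp [diagonalHom_apply, elementaryTensor_apply, h, hd i j h]
    exact hle ha
  · rintro ⟨F, rfl⟩
    refine NonUnitalStarSubalgebra.le_topologicalClosure _ ?_
    have : diagonalHom n F = ∑ i, elementaryTensor ((circleProdEquiv n).symm F i)
        (CStarMatrix.ofMatrix (Matrix.single i i 1)) := by
      ext i j z
      rw [CStarMatrix.sum_apply, ContinuousMap.coe_sum, Finset.sum_apply,
        Finset.sum_eq_single i]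
      · by_cases h : i = j <;>
          simp [diagonalHom_apply, elementaryTensor_apply, h]
      · intro l _ hl
        simp [elementaryTensor_apply, hl]
      · simp
    rw [this]
    refine sum_mem fun i _ => NonUnitalStarAlgebra.subset_adjoin ℂ _ ⟨_, _, ?_, rfl⟩
    intro j k hjk
    exact Matrix.single_apply_of_ne _ _ _ _ _ (by rintro ⟨rfl, rfl⟩; exact hjk rfl)

end CircleDiagonal

/-! ### Crossed products by finite groups as equivariant matrices -/

section CrossedProduct

variable {G : Type*} [Group G] [DecidableEq G] {B : Type*} [CStarAlgebra B]

theorem translation_apply (s t u : G) :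
    translation B s t u = if u = s⁻¹ * t then 1 else 0 := rfl

theorem translation_one : translation B (1 : G) = 1 := by
  ext t u
  simp [translation_apply, CStarMatrix.one_apply, eq_comm]

theorem star_translation (s : G) : star (translation B s) = translation B s⁻¹ := by
  ext t u
  rw [CStarMatrix.star_apply, translation_apply, translation_apply]
  by_cases h : u = s * t
  · simp [h]
  · rw [if_neg, if_neg, star_zero]
    · simpa using h
    · rintro rfl
      simp at h

variable [Fintype G]

theorem translation_mul_apply (s : G) (M : CStarMatrix G G B) (t u : G) :
    (translation B s * M) t u = M (s⁻¹ * t) u := by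
  simp [CStarMatrix.mul_apply, translation_apply]

theorem translation_mul_translation (s r : G) :
    translation B s * translation B r = translation B (s * r) := by
  ext t u
  simp [translation_mul_apply, translation_apply, mul_assoc]

variable [PartialOrder B] [StarOrderedRing B] {α : G →* (B ≃⋆ₐ[ℂ] B)}

theorem regularRep_apply (b : B) (t u : G) :
    regularRep α b t u = if t = u then α t⁻¹ b else 0 := by
  by_cases h : t = u <;> simp [h, regularRep]

theorem regularRep_mul_apply (b : B) (M : CStarMatrix G G B) (t u : G) :
    (regularRep α b * M) t u = α t⁻¹ b * M t u := by
  simp [CStarMatrix.mul_apply, regularRep_apply]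

theorem translation_mul_regularRep (s : G) (b : B) :
    translation B s * regularRep α b = regularRep α (α s b) * translation B s := by
  ext t u
  rw [translation_mul_apply, regularRep_mul_apply, regularRep_apply, translation_apply]
  by_cases h : u = s⁻¹ * t
  · simp [h]
  · simp [h, Ne.symm h]

/-- Equivariance determines `M` by its row at `1`: `M t u = α_{t⁻¹} (M 1 (u t⁻¹))`, and only `s = t
u⁻¹` contributes to the entry `(t, u)`. -/
theorem eq_sum_regularRep_mul_translation {M : CStarMatrix G G B}
    (hM : ∀ s t u, M (t * s) (u * s) = α s⁻¹ (M t u)) :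
    M = ∑ s, regularRep α (M 1 s⁻¹) * translation B s := by
  ext t u
  rw [CStarMatrix.sum_apply, Finset.sum_eq_single (t * u⁻¹)]
  · rw [regularRep_mul_apply, translation_apply, ← hM]
    simp
  · intro s _ hs
    rw [regularRep_mul_apply, translation_apply, if_neg, mul_zero]
    rintro rfl
    simp at hs
  · simp

/-- The crossed product consists of the equivariant matrices. -/
theorem mem_crossedProduct_iff {M : CStarMatrix G G B} :
    M ∈ crossedProduct α ↔ ∀ s t u, M (t * s) (u * s) = α s⁻¹ (M t u) := by
  constructor
  -- The equivariant matrices form a closed ⋆-subalgebra containing the generators.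
  · let S : StarSubalgebra ℂ (CStarMatrix G G B) :=
      { carrier := {M | ∀ s t u, M (t * s) (u * s) = α s⁻¹ (M t u)}
        mul_mem' := fun {M N} hM hN s t u => by
          simp only [Set.mem_ofPred_eq] at hM hN
          rw [CStarMatrix.mul_apply, CStarMatrix.mul_apply, map_sum]
          refine (Fintype.sum_equiv (Equiv.mulRight s) _ _ fun r => ?_).symm
          rw [map_mul, ← hM, ← hN, Equiv.coe_mulRight]
        one_mem' := fun s t u => by
          by_cases h : t = u <;> simp [h, CStarMatrix.one_apply, -map_inv]
        add_mem' := fun {M N} hM hN s t u => by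
          simp only [Set.mem_ofPred_eq] at hM hN
          rw [CStarMatrix.add_apply, CStarMatrix.add_apply, hM, hN, map_add]
        zero_mem' := fun s t u => by simp
        algebraMap_mem' := fun r s t u => by
          by_cases h : t = u <;>
            simp [h, CStarMatrix.algebraMap_apply, -map_inv, AlgHomClass.commutes]
        star_mem' := fun {M} hM s t u => by
          simp only [Set.mem_ofPred_eq] at hM
          rw [CStarMatrix.star_apply, CStarMatrix.star_apply, hM, map_star] }
    have hS : IsClosed (S : Set (CStarMatrix G G B)) := by
      have : (S : Set (CStarMatrix G G B))
          = ⋂ s, ⋂ t, ⋂ u, {M | M (t * s) (u * s) = α s⁻¹ (M t u)} := by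
        ext M
        simp only [Set.mem_iInter]
        rfl
      rw [this]
      have happ : ∀ t u : G, Continuous fun M : CStarMatrix G G B => M t u := fun t u =>
        (continuous_apply u).comp (continuous_apply (A := fun _ => G → B) t)
      exact isClosed_iInter fun s => isClosed_iInter fun t => isClosed_iInter fun u =>
        isClosed_eq (happ _ _) ((StarAlgEquiv.isometry (α s⁻¹)).continuous.comp (happ _ _))
    have hle : crossedProduct α ≤ S := by
      refine StarSubalgebra.topologicalClosure_minimal (StarAlgebra.adjoin_le ?_) hS
      rintro _ (⟨b, rfl⟩ | ⟨r, rfl⟩) s t u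
      · rw [regularRep_apply, regularRep_apply]
        by_cases h : t = u <;> simp [h, -map_inv]
      · simp only [translation_apply, ← mul_assoc, mul_left_inj]
        by_cases h : u = r⁻¹ * t <;> simp [h, -map_inv]
    exact fun hM => hle hM
  · intro hM
    rw [eq_sum_regularRep_mul_translation hM]
    refine sum_mem fun s _ => mul_mem ?_ ?_
    · exact StarSubalgebra.le_topologicalClosure _ (StarAlgebra.subset_adjoin ℂ _ (Or.inl ⟨_, rfl⟩))
    · exact StarSubalgebra.le_topologicalClosure _ (StarAlgebra.subset_adjoin ℂ _ (Or.inr ⟨_, rfl⟩))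

/-- The translation unitaries as elements of the crossed product. -/
def crossedProductUnitary (α : G →* (B ≃⋆ₐ[ℂ] B)) (s : G) : crossedProduct α :=
  ⟨translation B s, StarSubalgebra.le_topologicalClosure _
    (StarAlgebra.subset_adjoin ℂ _ (Or.inr ⟨s, rfl⟩))⟩

theorem coe_crossedProductEmbedding (b : B) :
    (crossedProductEmbedding α b : CStarMatrix G G B) = regularRep α b := rfl

/-- The crossed product of `C(X)` by a free action. -/
theorem isFreeCovariantSystem_crossedProduct {X : Type*} [TopologicalSpace X] [CompactSpace X]
    {α : G →* (C(X, ℂ) ≃⋆ₐ[ℂ] C(X, ℂ))} {σ : G → X ≃ₜ X}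
    (hσ : ∀ s (f : C(X, ℂ)), α s f = f.comp (σ s)) (hfree : ∀ x, Function.Injective fun g => σ g x)
    (hone : ∀ x, σ 1 x = x) :
    IsFreeCovariantSystem (crossedProductEmbedding α) (crossedProductUnitary α) σ 1
      fun s a => (a : CStarMatrix G G C(X, ℂ)) 1 s⁻¹ where
  injective f g h := by
    have h1 := congrArg (fun a : crossedProduct α => (a : CStarMatrix G G C(X, ℂ)) 1 1) h
    simpa [coe_crossedProductEmbedding, regularRep_apply] using h1
  star_mul_self s := Subtype.ext <| by
    change star (translation _ s) * translation _ s = 1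
    rw [star_translation, translation_mul_translation, inv_mul_cancel, translation_one]
  mul_star_self s := Subtype.ext <| by
    change translation _ s * star (translation _ s) = 1
    rw [star_translation, translation_mul_translation, mul_inv_cancel, translation_one]
  covariant s f := Subtype.ext <| by
    change translation _ s * regularRep α f = regularRep α (f.comp (σ s)) * translation _ s
    rw [translation_mul_regularRep, hσ]
  free := hfree
  unitary_one := Subtype.ext translation_one
  homeomorph_one := hone
  expansion a := Subtype.ext <| by
    refine (eq_sum_regularRep_mul_translation (mem_crossedProduct_iff.1 a.2)).trans ?_
    rw [AddSubmonoidClass.coe_finsetSum]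
    rfl

end CrossedProduct

/-! ### The rotation action on the circle -/

section Rotation

variable {n : ℕ} [NeZero n]

/-- The rotations of the circle by `n`-th roots of unity. -/
noncomputable def circleRotation (k : Multiplicative (ZMod n)) : Circle ≃ₜ Circle :=
  Homeomorph.mulLeft (ZMod.toCircle (-k.toAdd))

@[simp]
theorem circleRotation_apply (k : Multiplicative (ZMod n)) (z : Circle) :
    circleRotation k z = ZMod.toCircle (-k.toAdd) * z := rfl

theorem rotationAction_apply (k : Multiplicative (ZMod n)) (f : C(Circle, ℂ)) :
    rotationAction n k f = f.comp (circleRotation k) := rfl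

theorem isFreeCovariantSystem_rotation (n : ℕ) [NeZero n] :
    IsFreeCovariantSystem (crossedProductEmbedding (rotationAction n))
      (crossedProductUnitary (rotationAction n)) circleRotation 1
      fun s a =>
        (a : CStarMatrix (Multiplicative (ZMod n)) (Multiplicative (ZMod n)) C(Circle, ℂ)) 1 s⁻¹ :=
  isFreeCovariantSystem_crossedProduct rotationAction_apply
    (fun z k l h => by
      have h' : ZMod.toCircle (-k.toAdd) * z = ZMod.toCircle (-l.toAdd) * z := h
      simpa using ZMod.injective_toCircle (mul_right_cancel h'))
    (fun z => by simp)

/-- The quotient `z / w` is an `n`-th root of unity, and all of these are values of `ZMod.toCircle`.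
-/
theorem pow_eq_pow_iff_exists_rotation {z w : Circle} :
    z ^ n = w ^ n ↔ ∃ k : ZMod n, ZMod.toCircle k * w = z := by
  constructor
  · intro h
    have hr : (z / w) ^ n = 1 := by rw [div_pow, h, div_self']
    obtain ⟨k, hk⟩ := (bijective_rootsOfUnityAddChar n).2 ⟨toUnits (z / w), by
      rw [mem_rootsOfUnity, ← map_pow, hr, map_one]⟩
    refine ⟨k, ?_⟩
    have := congrArg (fun r : rootsOfUnity n Circle => ((r : Circleˣ) : Circle)) hk
    simp only [ZMod.rootsOfUnityAddChar_val] at this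
    rw [this]
    simp
  · rintro ⟨k, rfl⟩
    rw [mul_pow, ← AddChar.map_nsmul_eq_pow]
    simp

theorem mem_circleCopy_iff (Φ : CircleMatrixAlg n ≃⋆ₐ[ℂ] RotationCrossedProduct n)
    (a : CircleMatrixAlg n) :
    a ∈ circleCopy Φ ↔ ∃ f, Φ.symm (crossedProductEmbedding (rotationAction n) f) = a := by
  constructor
  · rintro ⟨_, ⟨f, rfl⟩, rfl⟩
    exact ⟨f, rfl⟩
  · rintro ⟨f, rfl⟩
    exact ⟨_, ⟨f, rfl⟩, rfl⟩

end Rotation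

/-! ### The isomorphism of `C(𝕋) ⊗ M_n(ℂ)` with the crossed product -/

section FourierIsomorphism

/-- The pullback of functions along `z ↦ z ^ n`. -/
noncomputable def powPullback (n : ℕ) : C(Circle, ℂ) →⋆ₐ[ℂ] C(Circle, ℂ) :=
  ContinuousMap.compStarAlgHom' ℂ ℂ ⟨fun z : Circle => z ^ n, by fun_prop⟩

theorem powPullback_apply {n : ℕ} (f : C(Circle, ℂ)) (z : Circle) : powPullback n f z = f (z ^ n) := rfl

variable (n : ℕ) [NeZero n]

theorem Circle.pow_surjective : Function.Surjective fun z : Circle => z ^ n := by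
  intro w
  obtain ⟨θ, rfl⟩ := Circle.exp_surjective w
  refine ⟨Circle.exp (θ / n), ?_⟩
  have hn : (n : ℝ) ≠ 0 := NeZero.ne _
  change Circle.exp (θ / n) ^ n = _
  rw [← Circle.exp_nsmul, nsmul_eq_mul, mul_div_cancel₀ _ hn]

variable {n}

theorem powPullback_injective : Function.Injective (powPullback n) := by
  intro f g h
  ext w
  obtain ⟨z, rfl⟩ := Circle.pow_surjective n w
  exact congrArg (fun k : C(Circle, ℂ) => k z) h

/-- The map `z ↦ z ^ n` is a quotient map whose fibres are the orbits of the rotations, so invariant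
functions descend. -/
theorem exists_powPullback_eq {f : C(Circle, ℂ)}
    (hf : ∀ (k : ZMod n) z, f (ZMod.toCircle k * z) = f z) : ∃ g, powPullback n g = f := by
  have hq : Topology.IsQuotientMap (⟨fun z : Circle => z ^ n, by fun_prop⟩ : C(Circle, Circle)) :=
    Topology.IsQuotientMap.of_surjective_continuous (Circle.pow_surjective n)
      (continuous_pow n)
  refine ⟨hq.lift f fun z w h => ?_, ?_⟩
  · obtain ⟨k, rfl⟩ := pow_eq_pow_iff_exists_rotation.1 h
    exact hf k w
  · exact hq.lift_comp f _

theorem sum_toCircle_pow (k : ZMod n) :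
    ∑ j : Fin n, (ZMod.toCircle k : ℂ) ^ (j : ℕ) = if k = 0 then (n : ℂ) else 0 := by
  rw [Fin.sum_univ_eq_sum_range fun j => (ZMod.toCircle k : ℂ) ^ j]
  split_ifs with hk
  · simp [hk]
  · have h1 : (ZMod.toCircle k : ℂ) ≠ 1 := fun h => hk (ZMod.injective_toCircle (by
      rw [AddChar.map_zero_eq_one]
      exact Circle.ext h))
    have h2 : (ZMod.toCircle k : ℂ) ^ n = 1 := by
      rw [← Circle.coe_pow, ← AddChar.map_nsmul_eq_pow]
      simp
    rw [geom_sum_eq h1, h2, sub_self, zero_div]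

/-- The unitary matrix of functions `(t, j) ↦ n^{-1/2} (e^{2πit/n} z)^j`. -/
noncomputable def fourierMatrix (n : ℕ) [NeZero n] :
    Matrix (Multiplicative (ZMod n)) (Fin n) C(Circle, ℂ) :=
  Matrix.of fun t j => ⟨fun z =>
    ((Real.sqrt n)⁻¹ : ℝ) * ((ZMod.toCircle t.toAdd * z : Circle) : ℂ) ^ (j : ℕ),
    by fun_prop⟩

theorem fourierMatrix_apply (t : Multiplicative (ZMod n)) (j : Fin n) (z : Circle) :
    fourierMatrix n t j z
      = ((Real.sqrt n)⁻¹ : ℝ) * ((ZMod.toCircle t.toAdd * z : Circle) : ℂ) ^ (j : ℕ) := rfl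

/-- Shifting the row index has the same effect as rotating the variable; this is what links
equivariant matrices to rotation-invariant ones. -/
theorem fourierMatrix_mul_apply (t s : Multiplicative (ZMod n)) (j : Fin n) (z : Circle) :
    fourierMatrix n (t * s) j z = fourierMatrix n t j (ZMod.toCircle s.toAdd * z) := by
  rw [fourierMatrix_apply, fourierMatrix_apply, toAdd_mul, AddChar.map_add_eq_mul, mul_assoc]

/-- Orthogonality of characters: in row `t` against row `u` the powers of `z` cancel because `|z| =
1`, leaving a geometric sum over a root of unity. -/
theorem fourierMatrix_mul_conjTranspose : fourierMatrix n * (fourierMatrix n)ᴴ = 1 := by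
  ext t u z
  have hterm : ∀ j : Fin n, fourierMatrix n t j z * star (fourierMatrix n u j z)
      = (n : ℂ)⁻¹ * (ZMod.toCircle (t.toAdd - u.toAdd) : ℂ) ^ (j : ℕ) := by
    intro j
    rw [fourierMatrix_apply, fourierMatrix_apply, RCLike.star_def, map_mul, map_pow,
      Complex.conj_ofReal, ← Circle.coe_inv_eq_conj, mul_mul_mul_comm, ← mul_pow, ← Circle.coe_mul,
      ← Complex.ofReal_mul, ← mul_inv, Real.mul_self_sqrt (Nat.cast_nonneg n)]
    rw [sub_eq_add_neg, AddChar.map_add_eq_mul, AddChar.map_neg_eq_inv]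
    congr 3
    · push_cast
      rfl
    · rw [mul_inv, mul_mul_mul_comm, mul_inv_cancel, mul_one]
  rw [Matrix.mul_apply, ContinuousMap.coe_sum, Finset.sum_apply]
  simp only [ContinuousMap.mul_apply, Matrix.conjTranspose_apply, ContinuousMap.star_apply, hterm]
  rw [← Finset.mul_sum, sum_toCircle_pow, Matrix.one_apply]
  have hn : (n : ℂ) ≠ 0 := NeZero.ne _
  by_cases h : t = u
  · simp [h, hn]
  · have : t.toAdd - u.toAdd ≠ 0 := fun h' => h (Multiplicative.toAdd.injective (sub_eq_zero.1 h'))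
    simp [h, this]

theorem conjTranspose_mul_fourierMatrix : (fourierMatrix n)ᴴ * fourierMatrix n = 1 :=
  (Matrix.mul_eq_one_comm_of_card_eq _ _ _ (by simp [Fintype.card_multiplicative, ZMod.card])).1
    fourierMatrix_mul_conjTranspose

/-- The conjugate of `a(z ^ n)` by the Fourier matrix. -/
noncomputable def fourierConj (a : CircleMatrixAlg n) :
    CStarMatrix (Multiplicative (ZMod n)) (Multiplicative (ZMod n)) C(Circle, ℂ) :=
  CStarMatrix.ofMatrix
    (fourierMatrix n * (CStarMatrix.ofMatrix.symm a).map (powPullback n) * (fourierMatrix n)ᴴ)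

/-- Shifting row and column by `s` rotates the argument of both Fourier factors, and the middle
factor `a(z ^ n)` does not notice the rotation. -/
theorem fourierConj_mem (a : CircleMatrixAlg n) :
    fourierConj a ∈ crossedProduct (rotationAction n) := by
  refine mem_crossedProduct_iff.2 fun s t u => ?_
  ext z
  rw [rotationAction_apply, ContinuousMap.comp_apply]
  simp only [fourierConj, CStarMatrix.ofMatrix_apply, Matrix.mul_apply, ContinuousMap.coe_sum,
    Finset.sum_apply, ContinuousMap.mul_apply, Matrix.conjTranspose_apply,
    ContinuousMap.star_apply, Matrix.map_apply, powPullback_apply, fourierMatrix_mul_apply]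
  have h : (circleRotation s⁻¹ z) = ZMod.toCircle s.toAdd * z := by simp
  have h' : (ZMod.toCircle s.toAdd * z) ^ n = z ^ n := pow_eq_pow_iff_exists_rotation.2 ⟨_, rfl⟩
  simp only [ContinuousMap.coe_coe, h, h']

theorem fourierConj_mul (a b : CircleMatrixAlg n) :
    fourierConj (a * b) = fourierConj a * fourierConj b := by
  set V := fourierMatrix n
  set M := (CStarMatrix.ofMatrix.symm a).map (powPullback n)
  set N := (CStarMatrix.ofMatrix.symm b).map (powPullback n)
  change V * ((CStarMatrix.ofMatrix.symm a * CStarMatrix.ofMatrix.symm b).map (powPullback n)) * Vᴴ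
    = (V * M * Vᴴ) * (V * N * Vᴴ)
  rw [Matrix.map_mul]
  calc V * (M * N) * Vᴴ = V * (M * ((1 : Matrix (Fin n) (Fin n) C(Circle, ℂ)) * N)) * Vᴴ := by
        rw [Matrix.one_mul]
    _ = V * (M * (Vᴴ * V * N)) * Vᴴ := by rw [conjTranspose_mul_fourierMatrix]
    _ = _ := by simp only [Matrix.mul_assoc]

theorem conjTranspose_mul_fourierConj_mul (a : CircleMatrixAlg n) :
    (fourierMatrix n)ᴴ * CStarMatrix.ofMatrix.symm (fourierConj a) * fourierMatrix n
      = (CStarMatrix.ofMatrix.symm a).map (powPullback n) := by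
  rw [fourierConj, Equiv.symm_apply_apply, Matrix.mul_assoc, Matrix.mul_assoc,
    conjTranspose_mul_fourierMatrix, Matrix.mul_one, ← Matrix.mul_assoc,
    conjTranspose_mul_fourierMatrix, Matrix.one_mul]

theorem fourierConj_injective : Function.Injective (fourierConj (n := n)) := by
  intro a b h
  have := conjTranspose_mul_fourierConj_mul a
  rw [h, conjTranspose_mul_fourierConj_mul] at this
  refine CStarMatrix.ext fun i j => ?_
  exact powPullback_injective (congrFun (congrFun this i) j).symm

theorem exists_fourierConj_eq
    {M : CStarMatrix (Multiplicative (ZMod n)) (Multiplicative (ZMod n)) C(Circle, ℂ)}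
    (hM : M ∈ crossedProduct (rotationAction n)) : ∃ a, fourierConj (n := n) a = M := by
  set V := fourierMatrix n with hV
  set N := Vᴴ * CStarMatrix.ofMatrix.symm M * V with hN
  rw [mem_crossedProduct_iff] at hM
  -- Rotating `z` shifts the indices of `V` and, by equivariance, of `M`; the shift is absorbed by
  -- reindexing the two sums.
  have hinv : ∀ i j (k : ZMod n) z, N i j (ZMod.toCircle k * z) = N i j z := by
    intro i j k z
    let s : Multiplicative (ZMod n) := Multiplicative.ofAdd k
    have hVs : ∀ t l, V t l (ZMod.toCircle k * z) = V (t * s) l z := fun t l =>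
      (fourierMatrix_mul_apply t s l z).symm
    have hMs : ∀ t u, M t u (ZMod.toCircle k * z) = M (t * s) (u * s) z := fun t u => by
      rw [hM, rotationAction_apply, ContinuousMap.comp_apply]
      simp [s]
    simp only [hN, Matrix.mul_apply, ContinuousMap.coe_sum, Finset.sum_apply,
      ContinuousMap.mul_apply, Matrix.conjTranspose_apply, ContinuousMap.star_apply,
      CStarMatrix.ofMatrix_symm_apply, hVs, hMs]
    refine Fintype.sum_equiv (Equiv.mulRight s) _ _ fun u => ?_
    congr 1
    exact Fintype.sum_equiv (Equiv.mulRight s) _ _ fun t => rfl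
  choose a ha using fun i j => exists_powPullback_eq (hinv i j)
  refine ⟨CStarMatrix.ofMatrix (Matrix.of a), ?_⟩
  have hmap : (Matrix.of a).map (powPullback n) = N := by
    refine Matrix.ext fun i j => ?_
    exact ha i j
  rw [fourierConj, Equiv.symm_apply_apply, hmap, hN, ← hV, Matrix.mul_assoc, Matrix.mul_assoc,
    Matrix.mul_assoc, fourierMatrix_mul_conjTranspose, Matrix.mul_one, ← Matrix.mul_assoc,
    fourierMatrix_mul_conjTranspose, Matrix.one_mul, Equiv.apply_symm_apply]

/-- `C(𝕋) ⊗ M_n(ℂ)` is isomorphic to the crossed product of `C(𝕋)` by the rotation of order `n`. -/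
noncomputable def fourierEquiv (n : ℕ) [NeZero n] :
    CircleMatrixAlg n ≃⋆ₐ[ℂ] RotationCrossedProduct n where
  toEquiv := Equiv.ofBijective (fun a => ⟨fourierConj a, fourierConj_mem a⟩)
    ⟨fun _ _ h => fourierConj_injective (Subtype.ext_iff.1 h), fun M => by
      obtain ⟨a, ha⟩ := exists_fourierConj_eq M.2
      exact ⟨a, Subtype.ext ha⟩⟩
  map_mul' a b := Subtype.ext (fourierConj_mul a b)
  map_add' a b := Subtype.ext <| by
    change fourierMatrix n * (CStarMatrix.ofMatrix.symm a + CStarMatrix.ofMatrix.symm b).map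
      (powPullback n) * (fourierMatrix n)ᴴ = _
    rw [Matrix.map_add _ (map_add _), Matrix.mul_add, Matrix.add_mul]
    rfl
  map_star' a := Subtype.ext <| by
    change fourierMatrix n * ((CStarMatrix.ofMatrix.symm a)ᴴ).map (powPullback n)
      * (fourierMatrix n)ᴴ = (fourierMatrix n * (CStarMatrix.ofMatrix.symm a).map (powPullback n)
      * (fourierMatrix n)ᴴ)ᴴ
    rw [Matrix.conjTranspose_mul, Matrix.conjTranspose_mul, Matrix.conjTranspose_conjTranspose,
      Matrix.mul_assoc, ← Matrix.conjTranspose_map _ fun f => map_star (powPullback n) f]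
  map_smul' c a := Subtype.ext <| by
    change fourierMatrix n * (c • CStarMatrix.ofMatrix.symm a).map (powPullback n)
      * (fourierMatrix n)ᴴ = c • (fourierMatrix n *
        (CStarMatrix.ofMatrix.symm a).map (powPullback n) * (fourierMatrix n)ᴴ)
    rw [Matrix.map_smul _ c (map_smul _ c), Matrix.mul_smul, Matrix.smul_mul]

end FourierIsomorphism

/-! ### The tensor product as matrices over `C(𝕋)` -/

section Tensor

variable (n : ℕ)

/-- `C(𝕋) ⊗ M_n(ℂ)` as the algebra of matrices over `C(𝕋)`. -/
noncomputable def circleTensorEquiv :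
    C(Circle, ℂ) ⊗[ℂ] MatrixAlg n ≃ₐ[ℂ] CircleMatrixAlg n :=
  (matrixEquivTensor (Fin n) ℂ C(Circle, ℂ)).symm

theorem circleTensorEquiv_tmul (f : C(Circle, ℂ)) (m : MatrixAlg n) :
    circleTensorEquiv n (f ⊗ₜ[ℂ] m) = elementaryTensor f m := by
  refine (matrixEquivTensor_apply_symm (Fin n) ℂ C(Circle, ℂ) f m).trans ?_
  ext i j z
  change f z * m i j = m i j * f z
  exact mul_comm _ _

theorem elementaryTensor_star (f : C(Circle, ℂ)) (m : MatrixAlg n) :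
    elementaryTensor (star f) (star m) = star (elementaryTensor f m) := by
  ext i j z
  simp [elementaryTensor_apply, CStarMatrix.star_apply]

theorem exists_tensor_starAlgEquiv :
    ∃ T : C(Circle, ℂ) ⊗[ℂ] MatrixAlg n ≃⋆ₐ[ℂ] CircleMatrixAlg n,
      ∀ f m, T (f ⊗ₜ[ℂ] m) = elementaryTensor f m :=
  ⟨StarAlgEquiv.ofAlgEquiv (circleTensorEquiv n) fun a => by
    induction a using TensorProduct.induction_on with
    | zero => simp
    | tmul f m =>
      rw [TensorProduct.star_tmul, circleTensorEquiv_tmul, circleTensorEquiv_tmul,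
        elementaryTensor_star]
    | add a b ha hb => rw [star_add, map_add, ha, hb, map_add, star_add],
    circleTensorEquiv_tmul n⟩

end Tensor

/-! ### Idempotents tell the two subalgebras apart -/

section NotIsomorphic

/-- An idempotent function takes only the values `0` and `1`, so its zero set is clopen. -/
theorem ContinuousMap.eq_zero_or_one_of_mul_self_eq {X : Type*} [TopologicalSpace X]
    [PreconnectedSpace X] {f : C(X, ℂ)} (hf : f * f = f) : f = 0 ∨ f = 1 := by
  have h01 : ∀ x, f x = 0 ∨ f x = 1 := fun x => by
    have : f x * f x = f x := congrArg (fun g : C(X, ℂ) => g x) hf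
    rcases eq_or_ne (f x) 0 with h | h
    · exact Or.inl h
    · exact Or.inr (mul_left_cancel₀ h (by rw [this, mul_one]))
  have hclopen : IsClopen {x | f x = 0} := by
    refine ⟨isClosed_eq f.continuous continuous_const, ?_⟩
    have : {x | f x = 0} = {x | f x ≠ 1} := by
      ext x
      rcases h01 x with h | h <;> simp [h]
    rw [this]
    exact isOpen_ne_fun f.continuous continuous_const
  rcases isClopen_iff.1 hclopen with h | h
  · right
    ext x
    exact (h01 x).resolve_left fun hx => (h ▸ hx : x ∈ (∅ : Set X))
  · left
    ext x
    exact (h ▸ Set.mem_univ x : x ∈ {x | f x = 0})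

theorem isEmpty_pi_ringEquiv {n : ℕ} (hn : 2 ≤ n) :
    IsEmpty ((Fin n → C(Circle, ℂ)) ≃+* C(Circle, ℂ)) := by
  refine ⟨fun e => ?_⟩
  let i : Fin n := ⟨0, by omega⟩
  let j : Fin n := ⟨1, by omega⟩
  have hij : j ≠ i := by simp [i, j]
  -- The idempotent supported on one coordinate is neither `0` nor, as `n ≥ 2`, equal to `1`.
  let p : Fin n → C(Circle, ℂ) := Pi.single i 1
  have hp : p * p = p := by
    rw [← Pi.single_mul, one_mul]
  rcases ContinuousMap.eq_zero_or_one_of_mul_self_eq (f := e p) (by rw [← map_mul, hp]) with h | h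
  · rw [map_eq_zero_iff e e.injective] at h
    have := congrFun h i
    simp [p] at this
  · rw [map_eq_one_iff e e.injective] at h
    have := congrFun h j
    simp [p, hij] at this

end NotIsomorphic

/-! ### The two diagonal subalgebras -/

theorem mainTheorem3 (n : ℕ) [NeZero n] (hn : 2 ≤ n) :
    -- matrices over the algebra of the circle form the tensor product
    (∃ T : C(Circle, ℂ) ⊗[ℂ] MatrixAlg n ≃⋆ₐ[ℂ] CircleMatrixAlg n,
      ∀ f m, T (f ⊗ₜ[ℂ] m) = elementaryTensor f m) ∧
    -- the first diagonal subalgebra, its identification with a power of the algebra of the circle,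
    -- and the corresponding equivalence relation
    IsDiagonalSubalgebra (circleDiagonal n) ∧
    (∃ (e : (Fin n → C(Circle, ℂ)) ≃⋆ₐ[ℂ] circleDiagonal n)
      (h : Circle × Fin n ≃ₜ WeakDual.characterSpace ℂ (circleDiagonal n)),
      (∀ f z i j, (e f : CircleMatrixAlg n) i j z = if i = j then f i z else 0) ∧
      (∀ p f, h p (e f) = f p.2 p.1) ∧
      (∀ p q, spectralRelation (circleDiagonal n) (h p) (h q) ↔ p.1 = q.1)) ∧
    Nonempty (Quot (spectralRelation (circleDiagonal n)) ≃ₜ Circle) ∧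
    -- the second diagonal subalgebra, through the crossed product
    Nonempty (CircleMatrixAlg n ≃⋆ₐ[ℂ] RotationCrossedProduct n) ∧
    ∀ Φ : CircleMatrixAlg n ≃⋆ₐ[ℂ] RotationCrossedProduct n,
      IsDiagonalSubalgebra (circleCopy Φ) ∧
      (∃ (e : C(Circle, ℂ) ≃⋆ₐ[ℂ] circleCopy Φ)
        (h : Circle ≃ₜ WeakDual.characterSpace ℂ (circleCopy Φ)),
        (∀ f, (e f : CircleMatrixAlg n) =
          Φ.symm (crossedProductEmbedding (rotationAction n) f)) ∧
        (∀ z f, h z (e f) = f z) ∧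
        (∀ z w, spectralRelation (circleCopy Φ) (h z) (h w) ↔ z ^ n = w ^ n)) ∧
      Nonempty (Quot (spectralRelation (circleCopy Φ)) ≃ₜ Circle) ∧
      -- the two are not isomorphic, even as rings, and are not conjugate
      IsEmpty (circleDiagonal n ≃+* circleCopy Φ) ∧
      ∀ Θ : CircleMatrixAlg n ≃⋆ₐ[ℂ] CircleMatrixAlg n,
        NonUnitalStarSubalgebra.map Θ (circleDiagonal n) ≠ circleCopy Φ := by
  have H1 := isFreeCovariantSystem_diagonalHom n
  have hB1 := mem_circleDiagonal_iff (n := n)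
  obtain ⟨h1, hh1⟩ := exists_homeomorph_characterSpace H1.injective hB1
  have hrel1 : ∀ p q, spectralRelation (circleDiagonal n) (h1 p) (h1 q) ↔ p.1 = q.1 := by
    intro p q
    rw [H1.spectralRelation_iff hB1 hh1]
    constructor
    · rintro ⟨k, rfl⟩
      rfl
    · intro h
      exact ⟨p.2 - q.2, Prod.ext h.symm (by simp)⟩
  let e1 : (Fin n → C(Circle, ℂ)) ≃⋆ₐ[ℂ] circleDiagonal n :=
    (circleProdEquiv n).trans (rangeEquiv H1.injective hB1)
  refine ⟨exists_tensor_starAlgEquiv n, H1.isDiagonalSubalgebra hB1,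
    ⟨e1, h1, fun f z i j => diagonalHom_apply _ i j z, fun p f => hh1 p _, hrel1⟩,
    nonempty_quot_homeomorph h1 continuous_fst Prod.fst_surjective hrel1, ⟨fourierEquiv n⟩,
    fun Φ => ?_⟩
  let ι : C(Circle, ℂ) →⋆ₐ[ℂ] CircleMatrixAlg n :=
    (Φ.symm : RotationCrossedProduct n →⋆ₐ[ℂ] CircleMatrixAlg n).comp
      (crossedProductEmbedding (rotationAction n))
  have H2 := (isFreeCovariantSystem_rotation n).map Φ.symm (ι' := ι) fun f => rfl
  have hB2 : ∀ a, a ∈ circleCopy Φ ↔ ∃ f, ι f = a := mem_circleCopy_iff Φ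
  obtain ⟨h2, hh2⟩ := exists_homeomorph_characterSpace H2.injective hB2
  have hrel2 : ∀ z w, spectralRelation (circleCopy Φ) (h2 z) (h2 w) ↔ z ^ n = w ^ n := by
    intro z w
    rw [H2.spectralRelation_iff hB2 hh2, pow_eq_pow_iff_exists_rotation]
    constructor
    · rintro ⟨k, rfl⟩
      -- The sign appears because `circleRotation k` multiplies by the root of unity of index `-k`.
      exact ⟨-k.toAdd, rfl⟩
    · rintro ⟨k, rfl⟩
      exact ⟨Multiplicative.ofAdd (-k), by simp⟩
  have hne : IsEmpty (circleDiagonal n ≃+* circleCopy Φ) := ⟨fun e =>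
    (isEmpty_pi_ringEquiv hn).false (e1.toRingEquiv.trans
      (e.trans (rangeEquiv H2.injective hB2).symm.toRingEquiv))⟩
  refine ⟨H2.isDiagonalSubalgebra hB2, ⟨rangeEquiv H2.injective hB2, h2, fun f => rfl, hh2, hrel2⟩,
    nonempty_quot_homeomorph h2 (continuous_pow n) (Circle.pow_surjective n) hrel2, hne,
    fun Θ hΘ => ?_⟩
  -- If `Θ` carried `B₁` onto `B₂`, then `B₂` would also be the range of `Θ ∘ diagonalHom n`, hence
  -- isomorphic to `B₁` as a ring.
  have hB3 : ∀ a, a ∈ circleCopy Φ ↔ ∃ F, Θ (diagonalHom n F) = a := by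
    intro a
    rw [← hΘ]
    constructor
    · rintro ⟨b, hb, rfl⟩
      obtain ⟨F, rfl⟩ := (hB1 b).1 hb
      exact ⟨F, rfl⟩
    · rintro ⟨F, rfl⟩
      exact ⟨_, (hB1 _).2 ⟨F, rfl⟩, rfl⟩
  let ι₃ : C(Circle × Fin n, ℂ) →⋆ₐ[ℂ] CircleMatrixAlg n :=
    (Θ : CircleMatrixAlg n →⋆ₐ[ℂ] CircleMatrixAlg n).comp (diagonalHom n)
  have H3 := H1.map Θ (ι' := ι₃) fun f => rfl
  exact hne.false ((rangeEquiv H1.injective hB1).symm.trans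
    (rangeEquiv (ι := ι₃) H3.injective hB3)).toRingEquiv
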